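/- Let $n\ge 1$ and let $p(r)=\sum_{i=0}^{n+1}\gamma_i r^i$ be a real polynomial of degree $n+1$ that is an even or an odd function and satisfies $p(0)=0$. Let $S$ be the $(n+1)$-dimensional space of all solutions $v:\mathbb R\to\mathbb R$ of $\sum_{i=0}^{n+1}\gamma_i v^{(i)}=0$ (identified with their restrictions to any interval $[0,\beta]$), and let $\varphi_{n,0},\dots,\varphi_{n,n}$ be a basis of $S$. For functions $f_0,\dots,f_m$ let $W_{[f_0,\dots,f_m]}(u)$ be the Wronskian matrix whose $(j,k)$ entry is $f_k^{(j)}(u)$. *Critical length.* Take any system $v_0,\dots,v_n$ in $S$ for which $W_{[v_0,\dots,v_n]}(0)$ is lower triangular with unit diagonal. Put $$\beta_n^\star=\min\{|u| : u\in\mathbb R\setminus\{0\},\ \det W_{[v_i,\dots,v_n]}(u)=0\text{ for some } \lfloor n/2\rfloor\le i\le n\},$$ with $\beta_n^\star=+\infty$ if there is no such $u$; this does not depend on the choice of the system. Let $0<\beta<\beta_n^\star$. *Normalized B-basis.* A normalized B-basis of $S$ on $[0,\beta]$ is a basis $(b_0,\dots,b_n)$ of $S$ such that: it is totally positive on $[0,\beta]$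 (all minors of its collocation matrices at increasing points of $[0,\beta]$ are non-negative); $\sum_i b_i=1$ on $[0,\beta]$; $b_0(0)=b_n(\beta)=1$; $b_i^{(j)}(0)=0$ for $j<i$ and $b_i^{(i)}(0)>0$; $b_i^{(j)}(\beta)=0$ for $j\le n-1-i$ and $(-1)^{n-i}b_i^{(n-i)}(\beta)>0$. Then the following hold. 1. $S$ contains the constants, is invariant under all maps $f\mapsto f(\tau-\cdot)$ and $f\mapsto f(\cdot-\tau)$, $\tau\in\mathbb R$, and is an extended Chebyshev (EC) space on $[0,\beta]$: every Hermite interpolation problem with $n+1$ conditions in total at nodes in $[0,\beta]$ has exactly one solution in $S$. 2. There is exactly one matrix $(\rho_{i,j})_{i,j=0}^n$ such that the functions $v_{n,i}=\sum_{j=0}^n\rho_{i,j}\varphi_{n,j}$ satisfy $v_{n,i}^{(j)}(0)=0$ for $j<i$, $v_{n,i}^{(i)}(0)=1$ and $v_{n,i}^{(j)}(\beta)=0$ for $0\le j\le n-1-i$ (a bicanonical system). These functions form a basis of $S$. 3. The matrix $W_{[v_{n,n},v_{n,n-1},\dots,v_{n,0}]}(\beta)$ has exactly one Doolittle factorization $L\cdot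 U$ ($L$ lower triangular with unit diagonal, $U$ non-singular upper triangular). 4. Write $U^{-1}=(\mu_{r,i})$ and $L^{-1}=(\lambda_{i,r})$, and put $[\tilde b_{n,n},\dots,\tilde b_{n,0}]=[v_{n,n},\dots,v_{n,0}]\cdot U^{-1}$ and $b_{n,n-i}=\lambda_{i,0}\tilde b_{n,n-i}$ for $i=0,\dots,n$. A family of functions in $S$ is a normalized B-basis of $S$ on $[0,\beta]$ if and only if it equals $(b_{n,0},\dots,b_{n,n})$ and $\lambda_{i,0}\mu_{i,i}>0$ for all $i=0,\dots,n$. In particular, if $S$ has a normalized B-basis on $[0,\beta]$, then it is unique and is the constructed system. 5. For all $i=0,\dots,n$, all integers $j\ge0$ and all $u\in\mathbb R$ (in particular $u=0$ and $u=\beta$), $$b_{n,n-i}^{(j)}(u)=\lambda_{i,0}\tilde b_{n,n-i}^{(j)}(u)=\lambda_{i,0}\sum_{r=0}^{i}\mu_{r,i}v_{n,n-r}^{(j)}(u)=\lambda_{i,0}\sum_{r=0}^{i}\mu_{r,i}\sum_{c=0}^{n}\rho_{n-r,c}\,\varphi_{n,c}^{(j)}(u),$$ $$b_{n,i}^{(j)}(u)=(-1)^j\,b_{n,n-i}^{(j)}(\beta-u).$$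 -/

import Mathlib

open scoped ContDiff

/-- The real vector space of all solutions on the real line of the constant-coefficient homogeneous
linear differential equation `∑ i, γ i * v^(i) = 0` with characteristic polynomial `p = ∑ i, γ i r^i`.
(Every solution is smooth, and every solution on an interval extends uniquely to the line, so the
solutions on `[0, β]` are exactly the restrictions of the elements of this space.) -/
def solutionSpace (p : Polynomial ℝ) : Submodule ℝ (ℝ → ℝ) where
  carrier := {v | ContDiff ℝ ∞ v ∧
    ∀ u, ∑ i ∈ Finset.range (p.natDegree + 1), p.coeff i * iteratedDeriv i v u = 0}
  zero_mem' := by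
    refine ⟨contDiff_const, fun u => Finset.sum_eq_zero fun i _ => ?_⟩
    have : iteratedDeriv i (0 : ℝ → ℝ) u = 0 := by
      simp
    rw [this, mul_zero]
  add_mem' := by
    rintro f g ⟨hf, hf'⟩ ⟨hg, hg'⟩
    refine ⟨hf.add hg, fun u => ?_⟩
    rw [← add_zero (0 : ℝ)]
    nth_rewrite 1 [← hf' u]
    rw [← hg' u, ← Finset.sum_add_distrib]
    refine Finset.sum_congr rfl fun i _ => ?_
    rw [iteratedDeriv_add ((hf.of_le (by exact_mod_cast le_top)).contDiffAt)
      ((hg.of_le (by exact_mod_cast le_top)).contDiffAt), mul_add]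
  smul_mem' := by
    rintro c f ⟨hf, hf'⟩
    refine ⟨contDiff_const.smul hf, fun u => ?_⟩
    rw [← mul_zero c, ← hf' u, Finset.mul_sum]
    refine Finset.sum_congr rfl fun i _ => ?_
    rw [iteratedDeriv_const_smul_field]
    simp only [smul_eq_mul]
    ring

/-- The family `f` is a basis of the function space `S`. -/
def IsBasisOf {m : ℕ} (S : Submodule ℝ (ℝ → ℝ)) (f : Fin m → ℝ → ℝ) : Prop :=
  LinearIndependent ℝ f ∧ Submodule.span ℝ (Set.range f) = S

/-- `S` is an extended Chebyshev space of dimension `n + 1` on `[a, b]`: every Hermite interpolation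
problem with `n + 1` conditions in total has exactly one solution in `S`. -/
def IsECSpace (n : ℕ) (S : Submodule ℝ (ℝ → ℝ)) (a b : ℝ) : Prop :=
  Module.finrank ℝ S = n + 1 ∧
  ∀ (r : ℕ) (t : Fin (r + 1) → ℝ) (m : Fin (r + 1) → ℕ) (ξ : Fin (r + 1) → ℕ → ℝ),
    StrictMono t → (∀ k, t k ∈ Set.Icc a b) → (∀ k, 0 < m k) → ∑ k, m k = n + 1 →
    ∃! f : ℝ → ℝ, f ∈ S ∧ ∀ k, ∀ l < m k, iteratedDeriv l f (t k) = ξ k l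

/-- The Wronskian matrix of a finite system: row `j` holds the `j`-th derivatives, column `k`
belongs to the function `f k`. -/
noncomputable def wronskianMatrix {m : ℕ} (f : Fin m → ℝ → ℝ) (u : ℝ) : Matrix (Fin m) (Fin m) ℝ :=
  Matrix.of fun j k => iteratedDeriv j (f k) u

/-- The subsystem `v i, v (i + 1), …, v n`. -/
def tailSystem {n : ℕ} (v : Fin (n + 1) → ℝ → ℝ) (i : Fin (n + 1)) :
    Fin (n + 1 - i) → ℝ → ℝ :=
  fun k => v ⟨i + k, by omega⟩

/-- The Wronskian matrix of `v` at `0` is lower triangular with unit diagonal. -/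
def IsCanonicalAtZero {n : ℕ} (v : Fin (n + 1) → ℝ → ℝ) : Prop :=
  ∀ i : Fin (n + 1), (∀ j < (i : ℕ), iteratedDeriv j (v i) 0 = 0) ∧ iteratedDeriv i (v i) 0 = 1

/-- `v` is bicanonical on `[0, β]`: `v i` has a zero of multiplicity at least `n - i` at `β`, a zero
of multiplicity `i` at `0`, and its `i`-th derivative at `0` equals one. -/
def IsBicanonical {n : ℕ} (β : ℝ) (v : Fin (n + 1) → ℝ → ℝ) : Prop :=
  IsCanonicalAtZero v ∧
  ∀ i : Fin (n + 1), ∀ j : ℕ, j + i < n → iteratedDeriv j (v i) β = 0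

/-- The critical length of an `(n + 1)`-dimensional space `S`: the least absolute value of a non-zero
real zero of one of the Wronskian determinants `det W[v i, …, v n]`, `⌊n / 2⌋ ≤ i ≤ n`, and `⊤` if
there is no such zero.  Here `v` is a system in `S` that is canonical at `0`; two such systems differ
by a unitriangular change of basis which preserves the span of each tail, so the determinants (and
the critical length) do not depend on its choice.  A system that is bicanonical on some interval
`[0, β]` is one possible choice. -/
noncomputable def criticalLength (n : ℕ) (S : Submodule ℝ (ℝ → ℝ)) : EReal :=
  sInf {x : EReal | ∃ v : Fin (n + 1) → ℝ → ℝ, (∀ i, v i ∈ S) ∧ IsCanonicalAtZero v ∧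
    ∃ i : Fin (n + 1), n / 2 ≤ (i : ℕ) ∧ ∃ u : ℝ, u ≠ 0 ∧
      (wronskianMatrix (tailSystem v i) u).det = 0 ∧ x = ((|u| : ℝ) : EReal)}

/-- The functions `v i = ∑ j, ρ i j * φ j`. -/
def particularIntegral {n : ℕ} (ρ : Matrix (Fin (n + 1)) (Fin (n + 1)) ℝ)
    (φ : Fin (n + 1) → ℝ → ℝ) (i : Fin (n + 1)) : ℝ → ℝ :=
  fun u => ∑ j, ρ i j * φ j u

/-- `A = L * U` is a Doolittle factorization: `L` is lower triangular with unit diagonal and `U` is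
a non-singular upper triangular matrix. -/
def IsDoolittle {m : ℕ} (A L U : Matrix (Fin m) (Fin m) ℝ) : Prop :=
  L * U = A ∧ (∀ i, L i i = 1) ∧ (∀ i j, i < j → L i j = 0) ∧
    (∀ i j, j < i → U i j = 0) ∧ U.det ≠ 0

/-- The functions `b̃ i`, defined by `[b̃ n, …, b̃ 0] = [v n, …, v 0] * U⁻¹`. -/
noncomputable def bTilde {n : ℕ} (v : Fin (n + 1) → ℝ → ℝ)
    (U : Matrix (Fin (n + 1)) (Fin (n + 1)) ℝ) (i : Fin (n + 1)) : ℝ → ℝ :=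
  fun u => Matrix.vecMul (fun r => v (Fin.rev r) u) U⁻¹ (Fin.rev i)

/-- The functions `b i = λ (n - i) 0 * b̃ i`, where `λ` are the entries of `L⁻¹`. -/
noncomputable def bFun {n : ℕ} (v : Fin (n + 1) → ℝ → ℝ)
    (L U : Matrix (Fin (n + 1)) (Fin (n + 1)) ℝ) (i : Fin (n + 1)) : ℝ → ℝ :=
  fun u => L⁻¹ (Fin.rev i) 0 * bTilde v U i u

/-- The system `b` is totally positive on `[0, β]`: all minors of all its collocation matrices at
increasing points are non-negative. -/
def IsTotallyPositiveOn {n : ℕ} (β : ℝ) (b : Fin (n + 1) → ℝ → ℝ) : Prop :=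
  ∀ (m : ℕ) (x : Fin m → ℝ) (c : Fin m → Fin (n + 1)), StrictMono x → StrictMono c →
    (∀ k, x k ∈ Set.Icc 0 β) → 0 ≤ (Matrix.of fun k l => b (c l) (x k)).det

/-- `b` is a normalized B-basis of `S` on `[0, β]`: a totally positive (in particular non-negative)
basis of `S` which is a partition of unity and satisfies the endpoint interpolation property and the
Hermite conditions at both ends of `[0, β]`. -/
structure IsNormalizedBBasis {n : ℕ} (S : Submodule ℝ (ℝ → ℝ)) (β : ℝ)
    (b : Fin (n + 1) → ℝ → ℝ) : Prop where
  basis : IsBasisOf S b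
  totallyPositive : IsTotallyPositiveOn β b
  sum_eq_one : ∀ u ∈ Set.Icc 0 β, ∑ i, b i u = 1
  left_value : b 0 0 = 1
  right_value : b (Fin.last n) β = 1
  left_zero : ∀ i : Fin (n + 1), ∀ j < (i : ℕ), iteratedDeriv j (b i) 0 = 0
  left_pos : ∀ i : Fin (n + 1), 0 < iteratedDeriv i (b i) 0
  right_zero : ∀ i : Fin (n + 1), ∀ j : ℕ, j + i < n → iteratedDeriv j (b i) β = 0
  right_pos : ∀ i : Fin (n + 1),
    0 < (-1 : ℝ) ^ (Fin.rev i : ℕ) * iteratedDeriv (Fin.rev i : ℕ) (b i) β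

/-! Everything rests on one zero bound: below the critical length a non-zero solution has at most
`n` zeros in `[0, β]`, counted with multiplicity. For zeros at the two points `0` and `u` only, this
is the non-vanishing of the tail Wronskians. The critical length controls just the upper half of the
tails; the parity of `p` makes the solution space reflection invariant, and reflection supplies the
other half (`eq_zero_of_two_point`). Repeated division and differentiation with Rolle's theorem then
passes from two points to arbitrary zeros in an open interval (`coeff_eq_zero_of_hasZeros`), and
translation invariance moves the closed interval inside an open one (`eq_zero_of_hasZeros`).

The bound makes Hermite interpolation unisolvent, by dimension, so the bicanonical system `v` exists
and is unique. Since `v i` vanishes `n - i` times at `β`, the reversed Wronskian at `β` is lower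
triangular; hence `U` is diagonal and every constructed function is a scalar multiple of `v i`. The
first column of `L * L⁻¹ = 1` says that these multiples sum to one.

Conversely, the endpoint conditions force any normalized B-basis to consist of multiples of the `v
i`, and the partition of unity fixes the factors. What remains is total positivity of `v` itself:
consecutive minors are positive by counting zeros, and Fekete's criterion
(`minors_pos_of_consecutive`) extends this to all minors. Thus positivity of the factors is the only
condition left in the characterization. -/

open scoped Topology

/-! ### Zeros counted with multiplicity, and Rolle's theorem -/

/-- `f` has a zero of multiplicity at least `r` at `u`. -/
def VanishesToOrder (f : ℝ → ℝ) (u : ℝ) (r : ℕ) : Prop :=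
  ∀ j < r, iteratedDeriv j f u = 0

/-- `f` has at least `k` zeros in `I`, counted with multiplicity. -/
def HasZeros (f : ℝ → ℝ) (I : Set ℝ) (k : ℕ) : Prop :=
  ∃ (Z : Finset ℝ) (m : ℝ → ℕ), ↑Z ⊆ I ∧ (∀ z ∈ Z, VanishesToOrder f z (m z)) ∧ k ≤ ∑ z ∈ Z, m z

namespace VanishesToOrder

variable {f g : ℝ → ℝ} {u : ℝ} {r s : ℕ}

theorem mono (h : VanishesToOrder f u r) (hs : s ≤ r) : VanishesToOrder f u s :=
  fun j hj => h j (hj.trans_le hs)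

theorem congr (h : VanishesToOrder f u r) (hfg : f =ᶠ[𝓝 u] g) : VanishesToOrder g u r :=
  fun j hj => by rw [← hfg.iteratedDeriv_eq j, h j hj]

theorem succ_iff : VanishesToOrder f u (r + 1) ↔ f u = 0 ∧ VanishesToOrder (deriv f) u r := by
  constructor
  · intro h
    refine ⟨by simpa using h 0 (by omega), fun j hj => ?_⟩
    rw [← iteratedDeriv_succ']
    exact h (j + 1) (by omega)
  · rintro ⟨h0, h1⟩ j hj
    cases j with
    | zero => simpa using h0
    | succ j => rw [iteratedDeriv_succ']; exact h1 j (by omega)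

theorem mul (h : VanishesToOrder f u r) (hf : ContDiffAt ℝ ∞ f u) (hg : ContDiffAt ℝ ∞ g u) :
    VanishesToOrder (fun x => f x * g x) u r := by
  intro j hj
  have := iteratedDeriv_mul (n := j) (hf.of_le (by exact_mod_cast le_top))
    (hg.of_le (by exact_mod_cast le_top))
  rw [show (fun x => f x * g x) = f * g from rfl, this]
  refine Finset.sum_eq_zero fun i hi => ?_
  rw [Finset.mem_range] at hi
  rw [h i (by omega)]
  ring

end VanishesToOrder

/-- Rolle's theorem for zeros counted with multiplicity. -/
theorem HasZeros.deriv {f : ℝ → ℝ} {I : Set ℝ} (hI : I.OrdConnected) (hf : ContinuousOn f I) {k : ℕ}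
    (h : HasZeros f I (k + 1)) : HasZeros (deriv f) I k := by
  obtain ⟨Z, m, hZ, hm, hk⟩ := h
  -- Each zero loses one multiplicity and each gap between neighbours gains a Rolle point. The
  -- clause `y ≤ z` keeps the zeros already found below the old maximum, so that the new Rolle point
  -- and the new maximum are not counted twice.
  have key : ∀ Z : Finset ℝ, ↑Z ⊆ I → (∀ z ∈ Z, VanishesToOrder f z (m z)) → (∀ z ∈ Z, 0 < m z) →
      Z.Nonempty → ∃ (Y : Finset ℝ) (l : ℝ → ℕ), ↑Y ⊆ I ∧ (∀ y ∈ Y, ∃ z ∈ Z, y ≤ z) ∧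
        (∀ y ∈ Y, VanishesToOrder (_root_.deriv f) y (l y)) ∧
        ∑ z ∈ Z, m z ≤ ∑ y ∈ Y, l y + 1 := by
    intro Z
    induction Z using Finset.induction_on_max with
    | empty => intro _ _ _ h; exact absurd h (by simp)
    | insert a s has ih =>
      intro hZ hm hpos _
      have hma : VanishesToOrder (_root_.deriv f) a (m a - 1) := by
        refine (VanishesToOrder.succ_iff.1 ?_).2
        have := hpos a (by simp)
        rw [Nat.sub_add_cancel this]
        exact hm a (by simp)
      have hasn : a ∉ s := fun h => lt_irrefl _ (has a h)
      have hf0 : ∀ z ∈ insert a s, f z = 0 := fun z hz => by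
        simpa using hm z hz 0 (hpos z hz)
      rcases s.eq_empty_or_nonempty with rfl | hs
      · refine ⟨{a}, fun _ => m a - 1, by simpa using hZ, by simp, by simpa using hma, ?_⟩
        have := hpos a (by simp)
        simp
        omega
      · obtain ⟨Y, l, hY, hYs, hl, hsum⟩ := ih (fun z hz => hZ (by simp at hz ⊢; exact Or.inr hz))
          (fun z hz => hm z (by simp [hz])) (fun z hz => hpos z (by simp [hz])) hs
        set b := s.max' hs with hb
        have hbs : b ∈ s := s.max'_mem hs
        have hba : b < a := has b hbs
        have haI : a ∈ I := hZ (by simp)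
        have hbI : b ∈ I := hZ (by simp [hbs])
        have hsub : Set.Icc b a ⊆ I := hI.out hbI haI
        obtain ⟨c, hc, hc'⟩ := exists_deriv_eq_zero hba (hf.mono hsub)
          ((hf0 b (by simp [hbs])).trans (hf0 a (by simp)).symm)
        have hYb : ∀ y ∈ Y, y ≤ b := fun y hy => by
          obtain ⟨z, hz, hyz⟩ := hYs y hy
          exact hyz.trans (s.le_max' z hz)
        have hcY : c ∉ Y := fun h => absurd (hYb c h) (not_le.2 hc.1)
        have haY : a ∉ Y := fun h => absurd (hYb a h) (not_le.2 hba)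
        have hca : c ≠ a := hc.2.ne
        refine ⟨insert c (insert a Y), Function.update (Function.update l a (m a - 1)) c 1,
          ?_, ?_, ?_, ?_⟩
        · intro y hy
          simp only [Finset.coe_insert, Set.mem_insert_iff, Finset.mem_coe] at hy
          rcases hy with rfl | rfl | hy
          · exact hsub ⟨hc.1.le, hc.2.le⟩
          · exact haI
          · exact hY hy
        · intro y hy
          simp only [Finset.mem_insert] at hy
          refine ⟨a, by simp, ?_⟩
          rcases hy with rfl | rfl | hy
          · exact hc.2.le
          · exact le_rfl
          · exact (hYb y hy).trans hba.le
        · intro y hy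
          simp only [Finset.mem_insert] at hy
          by_cases hyc : y = c
          · subst hyc
            rw [Function.update_self]
            intro j hj
            obtain rfl : j = 0 := by omega
            simpa using hc'
          rw [Function.update_of_ne hyc]
          by_cases hya : y = a
          · subst hya
            rwa [Function.update_self]
          rw [Function.update_of_ne hya]
          exact hl y (by tauto)
        · rw [Finset.sum_insert hasn, Finset.sum_insert (by simp [hca, hcY]),
            Finset.sum_insert haY, Function.update_self, Function.update_of_ne hca.symm,
            Function.update_self]
          have : ∑ y ∈ Y, Function.update (Function.update l a (m a - 1)) c 1 y
              = ∑ y ∈ Y, l y := Finset.sum_congr rfl fun y hy => by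
            rw [Function.update_of_ne (ne_of_mem_of_not_mem hy hcY),
              Function.update_of_ne (ne_of_mem_of_not_mem hy haY)]
          rw [this]
          have := hpos a (by simp)
          omega
  -- Points of multiplicity zero are discarded: `f` need not vanish there, so they cannot serve as
  -- endpoints for Rolle's theorem.
  set Z' := Z.filter (fun z => 0 < m z) with hZ'
  have hsum : ∑ z ∈ Z', m z = ∑ z ∈ Z, m z := by
    refine Finset.sum_filter_of_ne fun z _ hz => Nat.pos_of_ne_zero hz
  have hne : Z'.Nonempty := by
    by_contra hcon
    rw [Finset.not_nonempty_iff_eq_empty] at hcon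
    rw [hcon, Finset.sum_empty] at hsum
    omega
  obtain ⟨Y, l, hY, -, hl, hsum'⟩ := key Z'
    (fun z hz => hZ (by simp [hZ'] at hz ⊢; exact hz.1))
    (fun z hz => hm z (Finset.mem_filter.1 hz).1) (fun z hz => (Finset.mem_filter.1 hz).2) hne
  exact ⟨Y, l, hY, hl, by omega⟩

theorem HasZeros.exists_zero {f : ℝ → ℝ} {I : Set ℝ} {k : ℕ} (h : HasZeros f I (k + 1)) :
    ∃ z ∈ I, f z = 0 := by
  obtain ⟨Z, m, hZ, hm, hk⟩ := h
  obtain ⟨z, hz, hmz⟩ : ∃ z ∈ Z, m z ≠ 0 := by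
    by_contra! hcon
    rw [Finset.sum_eq_zero hcon] at hk
    omega
  exact ⟨z, hZ hz, by simpa using hm z hz 0 (Nat.pos_of_ne_zero hmz)⟩

/-! ### From zeros at one point to zeros in an interval -/

/-- If, for every `r ≤ k`, no non-trivial combination of `g 0, …, g (r - 1)` has an `r`-fold zero in
the open interval `I`, then no non-trivial combination of `g 0, …, g (k - 1)` has `k` zeros in `I`,
counted with multiplicity. -/
theorem coeff_eq_zero_of_hasZeros {I : Set ℝ} (hI : I.OrdConnected) (hIo : IsOpen I) (k : ℕ) :
    ∀ g : ℕ → ℝ → ℝ, (∀ i, ContDiffOn ℝ ∞ (g i) I) →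
    (∀ r ≤ k, ∀ u ∈ I, ∀ a : ℕ → ℝ,
      VanishesToOrder (fun x => ∑ i ∈ Finset.range r, a i * g i x) u r → ∀ i < r, a i = 0) →
    ∀ a : ℕ → ℝ, HasZeros (fun x => ∑ i ∈ Finset.range k, a i * g i x) I k → ∀ i < k, a i = 0 := by
  induction k with
  | zero => intro _ _ _ _ _ i hi; omega
  | succ k ih =>
    intro g hg hflag a hz
    -- The case `r = 1` of the hypothesis. One can therefore divide by `g 0` and differentiate,
    -- which removes `g 0` and, by Rolle, costs one zero; the induction runs on the derivatives of
    -- the quotients `g (i + 1) / g 0`.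
    have hne : ∀ x ∈ I, g 0 x ≠ 0 := by
      intro x hx h0
      have := hflag 1 (by omega) x hx (fun _ => 1) (by
        intro j hj
        obtain rfl : j = 0 := by omega
        simpa using h0) 0 (by omega)
      exact one_ne_zero this
    have hq : ∀ i, ContDiffOn ℝ ∞ (fun x => g i x / g 0 x) I := fun i => (hg i).div (hg 0) hne
    have hsumdiv : ∀ (r : ℕ) (a : ℕ → ℝ), ContDiffOn ℝ ∞
        (fun x => (∑ i ∈ Finset.range r, a i * g i x) / g 0 x) I := fun r a =>
      (ContDiffOn.sum fun i _ => contDiffOn_const.mul (hg i)).div (hg 0) hne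
    have hder : ∀ (r : ℕ) (a : ℕ → ℝ), ∀ x ∈ I,
        deriv (fun x => (∑ i ∈ Finset.range (r + 1), a i * g i x) / g 0 x) x =
        ∑ i ∈ Finset.range r, a (i + 1) * deriv (fun x => g (i + 1) x / g 0 x) x := by
      intro r a x hx
      have heq : (fun x => (∑ i ∈ Finset.range (r + 1), a i * g i x) / g 0 x) =ᶠ[𝓝 x]
          fun x => ∑ i ∈ Finset.range r, a (i + 1) * (g (i + 1) x / g 0 x) + a 0 := by
        filter_upwards [hIo.mem_nhds hx] with y hy
        rw [Finset.sum_range_succ', add_div, mul_div_assoc, div_self (hne y hy), mul_one,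
          Finset.sum_div]
        simp only [mul_div_assoc]
      have hd : ∀ i, DifferentiableAt ℝ (fun x => g i x / g 0 x) x := fun i =>
        ((hq i).contDiffAt (hIo.mem_nhds hx)).differentiableAt (by simp)
      rw [heq.deriv_eq, deriv_add_const, deriv_fun_sum fun i _ => (hd (i + 1)).const_mul _]
      exact Finset.sum_congr rfl fun i _ => deriv_const_mul _ (hd (i + 1))
    have hrec : ∀ i < k, a (i + 1) = 0 := by
      refine ih (fun i => deriv (fun x => g (i + 1) x / g 0 x)) (fun i =>
        ((contDiffOn_infty_iff_deriv_of_isOpen hIo).1 (hq (i + 1))).2) ?_ (fun i => a (i + 1)) ?_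
      · intro r hr u hu c hc
        -- The hypothesis passes to the quotient derivatives by integration: `F` is a primitive of
        -- the given combination, `F - F u` gains one order of vanishing at `u`, and multiplying by
        -- `g 0` turns the constant `-F u` into the coefficient of `g 0`.
        set c' : ℕ → ℝ := fun i => if i = 0 then 0 else c (i - 1) with hc'
        set F : ℝ → ℝ := fun x => (∑ i ∈ Finset.range (r + 1), c' i * g i x) / g 0 x with hF
        set d : ℕ → ℝ := fun i => if i = 0 then - F u else c (i - 1) with hd
        have hG : ∀ x ∈ I, (∑ i ∈ Finset.range (r + 1), d i * g i x) = (F x - F u) * g 0 x := by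
          intro x hx
          rw [sub_mul, hF]
          simp only
          rw [div_mul_cancel₀ _ (hne x hx), Finset.sum_range_succ', Finset.sum_range_succ']
          simp [hc', hd, hF]
          ring
        have hVF : VanishesToOrder (fun x => F x - F u) u (r + 1) := by
          rw [VanishesToOrder.succ_iff]
          refine ⟨sub_self _, hc.congr ?_⟩
          filter_upwards [hIo.mem_nhds hu] with y hy
          rw [deriv_sub_const, hF, hder r c' y hy]
          simp [hc']
        have hV := hVF.mul (((hsumdiv (r + 1) c').contDiffAt (hIo.mem_nhds hu)).sub
          contDiffAt_const) ((hg 0).contDiffAt (hIo.mem_nhds hu))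
        have hV' := hflag (r + 1) (by omega) u hu d (hV.congr (by
          filter_upwards [hIo.mem_nhds hu] with y hy
          exact (hG y hy).symm))
        intro i hi
        simpa [hd] using hV' (i + 1) (by omega)
      · have h1 : HasZeros (fun x => (∑ i ∈ Finset.range (k + 1), a i * g i x) / g 0 x) I
            (k + 1) := by
          obtain ⟨Z, m, hZ, hm, hk⟩ := hz
          refine ⟨Z, m, hZ, fun z hzZ => ?_, hk⟩
          have hzI := hIo.mem_nhds (hZ hzZ)
          simp only [div_eq_mul_inv]
          exact (hm z hzZ).mul (ContDiffAt.sum fun i _ => contDiffAt_const.mul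
            ((hg i).contDiffAt hzI)) (((hg 0).contDiffAt hzI).inv (hne z (hZ hzZ)))
        obtain ⟨Z, m, hZ, hm, hk⟩ := h1.deriv hI (hsumdiv (k + 1) a).continuousOn
        refine ⟨Z, m, hZ, fun z hzZ => (hm z hzZ).congr ?_, hk⟩
        filter_upwards [hIo.mem_nhds (hZ hzZ)] with y hy
        exact hder k a y hy
    intro i hi
    cases i with
    | succ i => exact hrec i (by omega)
    | zero =>
      obtain ⟨z, hzI, hz0⟩ := hz.exists_zero
      rw [Finset.sum_range_succ', Finset.sum_eq_zero fun i hi => by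
        rw [hrec i (Finset.mem_range.1 hi), zero_mul], zero_add] at hz0
      exact (mul_eq_zero.1 hz0).resolve_right (hne z hzI)

/-! ### Solutions: invariance, uniqueness and interpolation -/

theorem iteratedDeriv_sum_mul {ι : Type*} (s : Finset ι) (c : ι → ℝ) (f : ι → ℝ → ℝ)
    (hf : ∀ i ∈ s, ContDiff ℝ ∞ (f i)) (j : ℕ) (u : ℝ) :
    iteratedDeriv j (fun x => ∑ i ∈ s, c i * f i x) u = ∑ i ∈ s, c i * iteratedDeriv j (f i) u := by
  rw [iteratedDeriv_fun_sum fun i hi => (contDiff_const.mul ((hf i hi).of_le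
    (by exact_mod_cast le_top))).contDiffAt]
  exact Finset.sum_congr rfl fun i _ => by rw [iteratedDeriv_const_mul_field]

namespace solutionSpace

variable {p : Polynomial ℝ} {f : ℝ → ℝ}

theorem contDiff (hf : f ∈ solutionSpace p) : ContDiff ℝ ∞ f := hf.1

theorem sum_mul_mem {ι : Type*} (s : Finset ι) (c : ι → ℝ) (f : ι → ℝ → ℝ)
    (hf : ∀ i ∈ s, f i ∈ solutionSpace p) : (fun x => ∑ i ∈ s, c i * f i x) ∈ solutionSpace p := by
  have : (fun x => ∑ i ∈ s, c i * f i x) = ∑ i ∈ s, c i • f i := by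
    ext x
    simp
  rw [this]
  exact Submodule.sum_mem _ fun i hi => Submodule.smul_mem _ _ (hf i hi)

/-- The `j`-th derivative at `u`, as a linear functional. -/
noncomputable def jet (p : Polynomial ℝ) (j : ℕ) (u : ℝ) : solutionSpace p →ₗ[ℝ] ℝ where
  toFun f := iteratedDeriv j f u
  map_add' f g := iteratedDeriv_add ((contDiff f.2).of_le (by exact_mod_cast le_top)).contDiffAt
    ((contDiff g.2).of_le (by exact_mod_cast le_top)).contDiffAt
  map_smul' c f := iteratedDeriv_const_smul_field c f.1

theorem one_mem (hroot : p.eval 0 = 0) : (fun _ => (1 : ℝ)) ∈ solutionSpace p := by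
  refine ⟨contDiff_const, fun u => Finset.sum_eq_zero fun i _ => ?_⟩
  rw [iteratedDeriv_const]
  split_ifs with h
  · rw [h, Polynomial.coeff_zero_eq_eval_zero, hroot, zero_mul]
  · rw [mul_zero]

theorem comp_sub_const_mem (hf : f ∈ solutionSpace p) (τ : ℝ) :
    (fun u => f (u - τ)) ∈ solutionSpace p := by
  refine ⟨hf.1.comp (contDiff_id.sub contDiff_const), fun u => ?_⟩
  rw [← hf.2 (u - τ)]
  refine Finset.sum_congr rfl fun i _ => ?_
  rw [iteratedDeriv_comp_sub_const]

theorem coeff_comp_neg_X (p : Polynomial ℝ) (i : ℕ) :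
    (p.comp (-Polynomial.X)).coeff i = (-1) ^ i * p.coeff i := by
  rw [show (-Polynomial.X : Polynomial ℝ) = Polynomial.C (-1) * Polynomial.X by simp,
    Polynomial.comp_C_mul_X_coeff, mul_comm]

theorem comp_const_sub_mem (hpar : p.comp (-Polynomial.X) = p ∨ p.comp (-Polynomial.X) = -p)
    (hf : f ∈ solutionSpace p) (τ : ℝ) : (fun u => f (τ - u)) ∈ solutionSpace p := by
  refine ⟨hf.1.comp (contDiff_const.sub contDiff_id), fun u => ?_⟩
  have key : ∀ i, p.coeff i * iteratedDeriv i (fun u => f (τ - u)) u =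
      (p.comp (-Polynomial.X)).coeff i * iteratedDeriv i f (τ - u) := by
    intro i
    simp only [iteratedDeriv_comp_const_sub, coeff_comp_neg_X, smul_eq_mul]
    ring
  simp_rw [key]
  rcases hpar with h | h
  · rw [h, hf.2]
  · rw [h]
    simp only [Polynomial.coeff_neg, neg_mul, Finset.sum_neg_distrib, hf.2, neg_zero]

theorem _root_.VanishesToOrder.comp_const_sub {f : ℝ → ℝ} {τ u : ℝ} {r : ℕ}
    (h : VanishesToOrder f (τ - u) r) : VanishesToOrder (fun x => f (τ - x)) u r := by
  intro j hj
  simp only [iteratedDeriv_comp_const_sub, h j hj, smul_zero]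

theorem _root_.VanishesToOrder.comp_sub_const {f : ℝ → ℝ} {τ u : ℝ} {r : ℕ}
    (h : VanishesToOrder f (u - τ) r) : VanishesToOrder (fun x => f (x - τ)) u r := by
  intro j hj
  simp only [iteratedDeriv_comp_sub_const, h j hj]

variable {n : ℕ}

/-- A solution of an equation of order `n + 1` with an `(n + 1)`-fold zero vanishes. -/
theorem eq_zero_of_vanishesToOrder (hdeg : p.natDegree = n + 1) (hf : f ∈ solutionSpace p) {u : ℝ}
    (h : VanishesToOrder f u (n + 1)) : f = 0 := by
  have hlead : p.coeff (n + 1) ≠ 0 := by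
    rw [← hdeg]
    exact Polynomial.leadingCoeff_ne_zero.2 (by rintro rfl; simp at hdeg)
  -- The companion matrix: the jet `(f, f', …, f^(n))` solves the linear system `Y' = A Y` and is
  -- zero at `u`, so uniqueness for Lipschitz systems applies.
  let A : (Fin (n + 1) → ℝ) →ₗ[ℝ] (Fin (n + 1) → ℝ) := LinearMap.pi fun i =>
    if h : (i : ℕ) + 1 < n + 1 then LinearMap.proj ⟨i + 1, h⟩
    else ∑ j : Fin (n + 1), (-(p.coeff j / p.coeff (n + 1))) • LinearMap.proj j
  let A' := LinearMap.toContinuousLinearMap A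
  have hY : (fun t (i : Fin (n + 1)) => iteratedDeriv i f t) = fun _ => 0 := by
    refine ODE_solution_unique_univ (v := fun _ => A') (s := fun _ => Set.univ) (t₀ := u)
      (fun t => A'.lipschitz.lipschitzOnWith) (fun t => ⟨?_, trivial⟩) (fun t => ⟨?_, trivial⟩) ?_
    · rw [hasDerivAt_pi]
      intro i
      have hd := ((hf.1.differentiable_iteratedDeriv (i : ℕ)
        (by exact_mod_cast WithTop.coe_lt_top _)) t).hasDerivAt
      rw [← iteratedDeriv_succ] at hd
      convert hd using 1
      change A _ i = _
      by_cases hi : (i : ℕ) + 1 < n + 1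
      · simp only [A, LinearMap.pi_apply, dif_pos hi, LinearMap.proj_apply]
      · have hin : (i : ℕ) + 1 = n + 1 := by omega
        have hode := hf.2 t
        rw [hdeg, Finset.sum_range_succ, Finset.sum_range] at hode
        simp only [A, LinearMap.pi_apply, hin, lt_irrefl, dite_false, LinearMap.sum_apply,
          LinearMap.smul_apply, LinearMap.proj_apply, smul_eq_mul]
        rw [eq_comm, ← mul_right_inj' hlead, Finset.mul_sum]
        rw [eq_neg_of_add_eq_zero_right hode, ← Finset.sum_neg_distrib]
        refine Finset.sum_congr rfl fun j _ => ?_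
        field_simp
    · simpa using hasDerivAt_const t (0 : Fin (n + 1) → ℝ)
    · ext i
      exact h i i.2
  ext t
  simpa using congrFun (congrFun hY t) 0

theorem finrank_eq {S : Submodule ℝ (ℝ → ℝ)} {φ : Fin (n + 1) → ℝ → ℝ} (hφ : IsBasisOf S φ) :
    Module.finrank ℝ S = n + 1 := by
  rw [← hφ.2, finrank_span_eq_card hφ.1, Fintype.card_fin]

/-- A unisolvent system of `n + 1` point evaluations of derivatives can be interpolated. -/
theorem existsUnique_interpolation (hS : Module.finrank ℝ (solutionSpace p) = n + 1)
    {ι : Type*} [Fintype ι] (hι : Fintype.card ι = n + 1) (ord : ι → ℕ) (node : ι → ℝ)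
    (hinj : ∀ f ∈ solutionSpace p, (∀ i, iteratedDeriv (ord i) f (node i) = 0) → f = 0)
    (y : ι → ℝ) :
    ∃! f, f ∈ solutionSpace p ∧ ∀ i, iteratedDeriv (ord i) f (node i) = y i := by
  let E : solutionSpace p →ₗ[ℝ] (ι → ℝ) := LinearMap.pi fun i => jet p (ord i) (node i)
  have hEi : Function.Injective E := by
    rw [← LinearMap.ker_eq_bot, LinearMap.ker_eq_bot']
    intro f hf
    exact Subtype.ext (hinj f.1 f.2 fun i => congrFun hf i)
  have : FiniteDimensional ℝ (solutionSpace p) := FiniteDimensional.of_finrank_eq_succ hS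
  have hEs : Function.Surjective E :=
    (LinearMap.injective_iff_surjective_of_finrank_eq_finrank (by simp [hS, hι])).1 hEi
  obtain ⟨f, hf⟩ := hEs y
  refine ⟨f.1, ⟨f.2, fun i => congrFun hf i⟩, ?_⟩
  rintro g ⟨hg, hgy⟩
  have : E ⟨g, hg⟩ = E f := by
    rw [hf]
    exact funext hgy
  exact congrArg Subtype.val (hEi this)

/-- There is a basis of solutions which is dual to the derivatives at `0` of order at most `n`. -/
theorem exists_dual_system (hdeg : p.natDegree = n + 1)
    (hS : Module.finrank ℝ (solutionSpace p) = n + 1) :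
    ∃ v : Fin (n + 1) → ℝ → ℝ, (∀ i, v i ∈ solutionSpace p) ∧
      ∀ i j : Fin (n + 1), iteratedDeriv j (v i) 0 = if j = i then 1 else 0 := by
  choose v hv using fun i : Fin (n + 1) => (existsUnique_interpolation hS (by simp)
    (fun j : Fin (n + 1) => (j : ℕ)) (fun _ => 0)
    (fun f hf h => eq_zero_of_vanishesToOrder hdeg hf fun j hj => h ⟨j, hj⟩)
    (fun j => if j = i then 1 else 0)).exists
  exact ⟨v, fun i => (hv i).1, fun i => (hv i).2⟩

/-- Both sides have the same jet of order `n` at `0`, and this jet determines a solution. -/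
theorem eq_sum_of_dual (hdeg : p.natDegree = n + 1) {v : Fin (n + 1) → ℝ → ℝ}
    (hv : ∀ i, v i ∈ solutionSpace p)
    (hdual : ∀ i j : Fin (n + 1), iteratedDeriv j (v i) 0 = if j = i then 1 else 0)
    (hf : f ∈ solutionSpace p) : f = fun x => ∑ i : Fin (n + 1), iteratedDeriv i f 0 * v i x := by
  have hs := sum_mul_mem (p := p) Finset.univ (fun i : Fin (n + 1) => iteratedDeriv i f 0) v
    fun i _ => hv i
  rw [← sub_eq_zero]
  refine eq_zero_of_vanishesToOrder hdeg (u := 0) (Submodule.sub_mem _ hf hs) fun j hj => ?_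
  rw [iteratedDeriv_sub ((contDiff hf).of_le (by exact_mod_cast le_top)).contDiffAt
    ((contDiff hs).of_le (by exact_mod_cast le_top)).contDiffAt,
    iteratedDeriv_sum_mul _ _ _ fun i _ => contDiff (hv i)]
  have := fun i => hdual i ⟨j, hj⟩
  simp only at this
  simp [this]

/-! ### The zero bound below the critical length -/

/-- Below the critical length, no non-trivial solution has `n + 1` zeros at two points. -/
theorem eq_zero_of_two_point (hdeg : p.natDegree = n + 1)
    (hpar : p.comp (-Polynomial.X) = p ∨ p.comp (-Polynomial.X) = -p)
    (hS : Module.finrank ℝ (solutionSpace p) = n + 1) (hf : f ∈ solutionSpace p) {u : ℝ}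
    (hu : 0 < u) (hcrit : (u : EReal) < criticalLength n (solutionSpace p)) {s : ℕ}
    (h0 : VanishesToOrder f 0 s) (h1 : VanishesToOrder f u (n + 1 - s)) : f = 0 := by
  obtain ⟨v, hv, hdual⟩ := exists_dual_system hdeg hS
  have hcan : IsCanonicalAtZero v := fun i => by
    refine ⟨fun j hj => ?_, ?_⟩
    · have := hdual i ⟨j, hj.trans i.2⟩
      rw [if_neg (by simp [Fin.ext_iff, hj.ne])] at this
      exact this
    · rw [hdual i i, if_pos rfl]
  -- An `s`-fold zero at `0` leaves only `v s, …, v n` in the expansion of `g`; the zero at `u` then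
  -- says that the tail Wronskian matrix kills the coefficients, and its determinant is non-zero
  -- since `u` is below the critical length.
  have upper : ∀ (s : ℕ) (hs : s < n + 1), n / 2 ≤ s → ∀ g ∈ solutionSpace p,
      VanishesToOrder g 0 s → VanishesToOrder g u (n + 1 - s) → g = 0 := by
    intro s hs hns g hg hg0 hg1
    have hdet : (wronskianMatrix (tailSystem v ⟨s, hs⟩) u).det ≠ 0 := by
      intro hzero
      refine absurd hcrit (not_lt.2 (sInf_le ⟨v, hv, hcan, ⟨s, hs⟩, hns, u, hu.ne', hzero, ?_⟩))
      rw [abs_of_pos hu]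
    have hsum : g = fun x => ∑ k : Fin (n + 1 - s),
        iteratedDeriv (s + k) g 0 * tailSystem v ⟨s, hs⟩ k x := by
      ext x
      refine (congrFun (eq_sum_of_dual hdeg hv hdual hg) x).trans ?_
      let G : ℕ → ℝ := fun i => if hi : i < n + 1 then iteratedDeriv i g 0 * v ⟨i, hi⟩ x else 0
      have e1 : ∑ i : Fin (n + 1), iteratedDeriv i g 0 * v i x = ∑ i ∈ Finset.range (n + 1), G i := by
        rw [Finset.sum_range]
        exact Finset.sum_congr rfl fun i _ => by simp only [G, i.2, dite_true]
      have e2 : ∑ k : Fin (n + 1 - s), iteratedDeriv (s + k) g 0 * tailSystem v ⟨s, hs⟩ k x =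
          ∑ k ∈ Finset.range (n + 1 - s), G (s + k) := by
        rw [Finset.sum_range]
        refine Finset.sum_congr rfl fun k _ => ?_
        have : s + (k : ℕ) < n + 1 := by omega
        simp only [G, this, dite_true]
        rfl
      rw [e1, e2, ← Finset.sum_range_add_sum_Ico G hs.le, Finset.sum_Ico_eq_sum_range,
        Finset.sum_eq_zero, zero_add]
      intro i hi
      rw [Finset.mem_range] at hi
      simp only [G]
      rw [hg0 i hi]
      simp
    have hmv : Matrix.mulVec (wronskianMatrix (tailSystem v ⟨s, hs⟩) u)
        (fun k => iteratedDeriv (s + k) g 0) = 0 := by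
      ext j
      have := hg1 j j.2
      rw [hsum, iteratedDeriv_sum_mul _ _ (tailSystem v ⟨s, hs⟩) fun i _ => contDiff (hv _)] at this
      simp only [Matrix.mulVec, dotProduct, wronskianMatrix, Matrix.of_apply, Pi.zero_apply]
      refine Eq.trans (Finset.sum_congr rfl fun i _ => mul_comm _ _) this
    have hz := Matrix.eq_zero_of_mulVec_eq_zero hdet hmv
    rw [hsum]
    ext x
    refine Finset.sum_eq_zero fun k _ => ?_
    rw [show iteratedDeriv (s + k) g 0 = 0 from congrFun hz k, zero_mul]
  by_cases hs : n + 1 ≤ s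
  · exact eq_zero_of_vanishesToOrder hdeg hf (h0.mono hs)
  by_cases hs0 : s = 0
  · exact eq_zero_of_vanishesToOrder hdeg hf (h1.mono (by omega))
  by_cases hns : n / 2 ≤ s
  · exact upper s (by omega) hns f hf h0 h1
  -- Reflection about `u / 2` exchanges the two zeros, and `n + 1 - s` lies in the range controlled
  -- by the critical length.
  · have := upper (n + 1 - s) (by omega) (by omega) _ (comp_const_sub_mem hpar hf u)
      (VanishesToOrder.comp_const_sub (by simpa using h1))
      (VanishesToOrder.comp_const_sub (by simpa using h0.mono (by omega)))
    ext x
    simpa using congrFun this (u - x)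

/-- With the dual system in reversed order, a combination of the first `r` functions automatically
has `n + 1 - r` zeros at `0`. An additional `r`-fold zero at `u` is thus excluded by the two-point
case, which is the hypothesis of `coeff_eq_zero_of_hasZeros`. The interval is open because the first
function `v n` vanishes at `0`. -/
theorem eq_zero_of_hasZeros_Ioo (hdeg : p.natDegree = n + 1)
    (hpar : p.comp (-Polynomial.X) = p ∨ p.comp (-Polynomial.X) = -p)
    (hS : Module.finrank ℝ (solutionSpace p) = n + 1) (hf : f ∈ solutionSpace p) {b : ℝ}
    (hcrit : (b : EReal) < criticalLength n (solutionSpace p))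
    (h : HasZeros f (Set.Ioo 0 b) (n + 1)) : f = 0 := by
  obtain ⟨v, hv, hdual⟩ := exists_dual_system hdeg hS
  let g : ℕ → ℝ → ℝ := fun i => v (Fin.ofNat (n + 1) (n - i))
  have hg : ∀ i, g i ∈ solutionSpace p := fun i => hv _
  have hgj : ∀ i ≤ n, ∀ j ≤ n, iteratedDeriv j (g i) 0 = if j = n - i then 1 else 0 := by
    intro i hi j hj
    refine (hdual (Fin.ofNat (n + 1) (n - i)) ⟨j, by omega⟩).trans ?_
    simp only [Fin.ext_iff, Fin.ofNat, Nat.mod_eq_of_lt (show n - i < n + 1 by omega)]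
  have hjet : ∀ r ≤ n + 1, ∀ a : ℕ → ℝ, ∀ j ≤ n,
      iteratedDeriv j (fun x => ∑ i ∈ Finset.range r, a i * g i x) 0 =
        if n - j < r then a (n - j) else 0 := by
    intro r hr a j hj
    rw [iteratedDeriv_sum_mul _ _ _ fun i _ => contDiff (hg i)]
    rw [Finset.sum_congr rfl (g := fun i => if i = n - j then a i else 0), Finset.sum_ite_eq']
    · simp
    · intro i hi
      rw [Finset.mem_range] at hi
      rw [hgj i (by omega) j hj]
      by_cases hij : i = n - j
      · rw [if_pos hij, if_pos (by omega), mul_one]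
      · rw [if_neg hij, if_neg (by omega), mul_zero]
  have hsum : f = fun x => ∑ i ∈ Finset.range (n + 1), iteratedDeriv (n - i) f 0 * g i x := by
    ext x
    rw [Finset.sum_range]
    refine (congrFun (eq_sum_of_dual hdeg hv hdual hf) x).trans
      ((Equiv.sum_comp Fin.revPerm _).symm.trans ?_)
    refine Finset.sum_congr rfl fun i _ => ?_
    have : Fin.ofNat (n + 1) (n - (i : ℕ)) = Fin.rev i := by
      ext
      simp only [Fin.ofNat, Fin.val_rev, Nat.mod_eq_of_lt (show n - (i : ℕ) < n + 1 by omega)]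
      omega
    simp only [g, this, Fin.revPerm_apply]
    congr 2
    simp
  have key := coeff_eq_zero_of_hasZeros (I := Set.Ioo 0 b) Set.ordConnected_Ioo isOpen_Ioo (n + 1) g
    (fun i => (contDiff (hg i)).contDiffOn) ?_ (fun i => iteratedDeriv (n - i) f 0)
    (by rwa [← hsum])
  · rw [hsum]
    ext x
    exact Finset.sum_eq_zero fun i hi => by rw [key i (Finset.mem_range.1 hi), zero_mul]
  · intro r hr u hu a hV i hi
    have hz := eq_zero_of_two_point hdeg hpar hS (sum_mul_mem (Finset.range r) a g fun i _ => hg i)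
      hu.1 (lt_trans (by exact_mod_cast hu.2) hcrit) (s := n + 1 - r) (fun j hj => by
        rw [hjet r hr a j (by omega), if_neg (by omega)]) (hV.mono (by omega))
    have := hjet r hr a (n - i) (by omega)
    rw [hz, if_pos (by omega), show n - (n - i) = i by omega] at this
    rw [← this]
    simp

/-- Below the critical length, a non-trivial solution has at most `n` zeros. -/
theorem eq_zero_of_hasZeros (hdeg : p.natDegree = n + 1)
    (hpar : p.comp (-Polynomial.X) = p ∨ p.comp (-Polynomial.X) = -p)
    (hS : Module.finrank ℝ (solutionSpace p) = n + 1) (hf : f ∈ solutionSpace p) {β : ℝ}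
    (hcrit : (β : EReal) < criticalLength n (solutionSpace p))
    (h : HasZeros f (Set.Icc 0 β) (n + 1)) : f = 0 := by
  obtain ⟨b, hβb, hb⟩ := EReal.lt_iff_exists_real_btwn.1 hcrit
  rw [EReal.coe_lt_coe_iff] at hβb
  obtain ⟨Z, m, hZ, hm, hk⟩ := h
  -- The shift that centres `[0, β]` inside `(0, b)`; `b` is still below the critical length.
  set δ := (b - β) / 2 with hδ
  have h' : HasZeros (fun x => f (x - δ)) (Set.Ioo 0 b) (n + 1) := by
    refine ⟨Z.map (addRightEmbedding δ), fun x => m (x - δ), ?_, ?_, ?_⟩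
    · intro x hx
      simp only [Finset.coe_map, Set.mem_image, Finset.mem_coe, addRightEmbedding_apply] at hx
      obtain ⟨z, hz, rfl⟩ := hx
      have := hZ hz
      exact ⟨by linarith [this.1], by linarith [this.2]⟩
    · intro x hx
      simp only [Finset.mem_map, addRightEmbedding_apply] at hx
      obtain ⟨z, hz, rfl⟩ := hx
      exact VanishesToOrder.comp_sub_const (by simpa using hm z hz)
    · simpa using hk
  have := eq_zero_of_hasZeros_Ioo hdeg hpar hS (comp_sub_const_mem hf δ) hb h'
  ext x
  simpa using congrFun this (x + δ)

theorem isECSpace (hdeg : p.natDegree = n + 1)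
    (hpar : p.comp (-Polynomial.X) = p ∨ p.comp (-Polynomial.X) = -p)
    (hS : Module.finrank ℝ (solutionSpace p) = n + 1) {β : ℝ}
    (hcrit : (β : EReal) < criticalLength n (solutionSpace p)) :
    IsECSpace n (solutionSpace p) 0 β := by
  refine ⟨hS, fun r t m ξ ht htI _ hsum => ?_⟩
  have hcard : Fintype.card (Σ k, Fin (m k)) = n + 1 := by simpa using hsum
  suffices hinj : ∀ f ∈ solutionSpace p,
      (∀ i : Σ k, Fin (m k), iteratedDeriv (i.2 : ℕ) f (t i.1) = 0) → f = 0 by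
    obtain ⟨f, ⟨hf, hfξ⟩, huniq⟩ := existsUnique_interpolation hS hcard (fun i => (i.2 : ℕ))
      (fun i => t i.1) hinj (fun i => ξ i.1 i.2)
    exact ⟨f, ⟨hf, fun k l hl => hfξ ⟨k, l, hl⟩⟩, fun g hg => huniq g ⟨hg.1, fun i =>
      hg.2 i.1 i.2 i.2.2⟩⟩
  intro f hf h
  refine eq_zero_of_hasZeros hdeg hpar hS hf hcrit
    ⟨Finset.univ.map ⟨t, ht.injective⟩, fun z => ∑ k, if t k = z then m k else 0, ?_, ?_, ?_⟩
  · intro z hz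
    simp only [Finset.coe_map, Function.Embedding.coeFn_mk, Finset.coe_univ, Set.image_univ,
      Set.mem_range] at hz
    obtain ⟨k, rfl⟩ := hz
    exact htI k
  · intro z hz
    simp only [Finset.mem_map, Finset.mem_univ, Function.Embedding.coeFn_mk, true_and] at hz
    obtain ⟨k, rfl⟩ := hz
    intro j hj
    simp only [ht.injective.eq_iff, Finset.sum_ite_eq', Finset.mem_univ, if_true] at hj
    exact h ⟨k, j, hj⟩
  · simp [ht.injective.eq_iff, hsum]

end solutionSpace

/-! ### Fekete's criterion for positive minors -/

/-- The cofactor expansion along a repeated row vanishes. -/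
theorem Matrix.sum_neg_one_pow_mul_det_succAbove {m : ℕ} (A : Matrix (Fin m) (Fin (m + 1)) ℝ)
    (k : Fin m) :
    ∑ i : Fin (m + 1), (-1) ^ (i : ℕ) * A k i * (A.submatrix id i.succAbove).det = 0 := by
  let B : Matrix (Fin (m + 1)) (Fin (m + 1)) ℝ := Matrix.of (Fin.cons (A k) A)
  have hB : B.det = 0 := Matrix.det_zero_of_row_eq (Fin.succ_ne_zero k).symm (by
    ext j
    rfl)
  rw [Matrix.det_succ_row_zero] at hB
  rw [← hB]
  refine Finset.sum_congr rfl fun i _ => ?_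
  congr 2

/-- If all minors with consecutive columns are positive, then so are all minors. -/
theorem minors_pos_of_consecutive {X : Type*} [Preorder X] {N : ℕ} (K : X → ℕ → ℝ)
    (h : ∀ (m : ℕ) (x : Fin m → X), StrictMono x → ∀ c, c + m ≤ N →
      0 < (Matrix.of fun k l : Fin m => K (x k) (c + l)).det) (m : ℕ) :
    ∀ (d : ℕ) (c : ℕ → ℕ), (∀ i, i + 1 < m → c i < c (i + 1)) → (∀ i < m, c i < N) →
      c (m - 1) - c 0 ≤ d → ∀ x : Fin m → X, StrictMono x →
      0 < (Matrix.of fun k l : Fin m => K (x k) (c l)).det := by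
  induction m with
  | zero => intros; simp
  | succ m ihm =>
  cases m with
  | zero =>
    intro d c _ hN _ x hx
    have := h 1 x hx (c 0) (by have := hN 0 (by omega); omega)
    simpa using this
  | succ s =>
  -- For minors of a fixed size, induction on the spread of the columns. Filling a gap with the
  -- column `c l + 1` gives one column too many; deleting the first or the last one lowers the
  -- spread, deleting the inserted one gives back `c`. A three-term identity relates these minors.
  -- Spread zero is impossible for two or more columns.
  intro d
  induction d with
  | zero =>
    intro c hc hN hd
    have mono : ∀ j, ∀ i, i < j → j < s + 2 → c i < c j := by
      intro j
      induction j with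
      | zero => intro i hi; omega
      | succ j ih =>
        intro i hi hj
        rcases Nat.lt_succ_iff_lt_or_eq.1 hi with h | rfl
        · exact (ih i h (by omega)).trans (hc j (by omega))
        · exact hc i (by omega)
    have := mono (s + 1) 0 (by omega) (by omega)
    simp only [Nat.add_sub_cancel] at hd
    omega
  | succ d ihd =>
    intro c hc hN hd x hx
    by_cases hcons : ∀ l < s + 1, c (l + 1) = c l + 1
    · have hcl : ∀ l < s + 2, c l = c 0 + l := by
        intro l
        induction l with
        | zero => simp
        | succ l ih => intro hl; rw [hcons l (by omega), ih (by omega)]; ring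
      have := h (s + 2) x hx (c 0) (by
        have := hcl (s + 1) (by omega)
        have := hN (s + 1) (by omega)
        omega)
      convert this using 5 with k l
      exact congrArg (K (x k)) (hcl l l.2)
    push Not at hcons
    obtain ⟨l, hl, hgap⟩ := hcons
    have hgap' : c l + 1 < c (l + 1) := by
      have := hc l (by omega)
      omega
    -- the columns of `c` together with the new column `c l + 1`, in increasing order
    let w : ℕ → ℕ := fun j => if j ≤ l then c j else if j = l + 1 then c l + 1 else c (j - 1)
    have hw : ∀ i, i + 1 < s + 3 → w i < w (i + 1) := by
      intro i hi
      simp only [w]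
      rcases lt_trichotomy i l with h1 | rfl | h1
      · rw [if_pos h1.le, if_pos (by omega)]
        exact hc i (by omega)
      · simp
      · rw [if_neg (by omega), if_neg (by omega : ¬ i + 1 ≤ l), if_neg (by omega : i + 1 ≠ l + 1)]
        by_cases h2 : i = l + 1
        · subst h2
          simpa using hgap'
        · rw [if_neg h2]
          have := hc (i - 1) (by omega)
          rwa [Nat.sub_add_cancel (by omega)] at this
    have hwmono : ∀ j, ∀ i, i < j → j < s + 3 → w i < w j := by
      intro j
      induction j with
      | zero => intro i hi; omega
      | succ j ih =>
        intro i hi hj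
        rcases Nat.lt_succ_iff_lt_or_eq.1 hi with h | rfl
        · exact (ih i h (by omega)).trans (hw j (by omega))
        · exact hw i (by omega)
    have hw0 : w 0 = c 0 := by simp [w]
    have hwl : w (s + 2) = c (s + 1) := by
      simp only [w]
      rw [if_neg (by omega), if_neg (by omega)]
      rfl
    have hwN : ∀ i < s + 3, w i < N := by
      intro i hi
      have h1 := hN (s + 1) (by omega)
      rcases Nat.lt_or_ge i (s + 2) with h2 | h2
      · have := hwmono (s + 2) i h2 (by omega)
        omega
      · rw [show i = s + 2 by omega]
        omega
    let A : Matrix (Fin (s + 2)) (Fin (s + 3)) ℝ := Matrix.of fun k i => K (x k) (w i)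
    let D : Fin (s + 3) → ℝ := fun i => (A.submatrix id i.succAbove).det
    let P : Fin (s + 3) := ⟨l + 1, by omega⟩
    have hD0 : 0 < D 0 := by
      refine ihd (fun j => w (j + 1)) (fun i hi => hw _ (by omega)) (fun i hi => hwN _ (by omega))
        ?_ x hx
      have : w 0 < w 1 := hwmono 1 0 (by omega) (by omega)
      simp only [show s + 1 + 1 - 1 + 1 = s + 2 by omega, hwl, zero_add]
      simp only [Nat.add_sub_cancel] at hd
      omega
    have hDl : 0 < D (Fin.last _) := by
      have := ihd w (fun i hi => hw _ (by omega)) (fun i hi => hwN _ (by omega))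
        (by
          have := hwmono (s + 2) (s + 1) (by omega) (by omega)
          simp only [Nat.add_sub_cancel] at hd ⊢
          omega) x hx
      have e : D (Fin.last _) = (Matrix.of fun k j : Fin (s + 2) => K (x k) (w j)).det := by
        refine congrArg Matrix.det ?_
        ext k j
        simp [A]
      rwa [e]
    have hDP : D P = (Matrix.of fun k l : Fin (s + 2) => K (x k) (c l)).det := by
      refine congrArg Matrix.det ?_
      ext k j
      simp only [A, P, Matrix.submatrix_apply, Matrix.of_apply, id]
      congr 1
      by_cases hj : (j : ℕ) < l + 1
      · rw [Fin.succAbove_of_castSucc_lt _ _ (by simpa [Fin.lt_def] using hj)]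
        simp only [w, Fin.val_castSucc]
        rw [if_pos (by omega)]
      · rw [Fin.succAbove_of_le_castSucc _ _ (by simp [Fin.le_def]; omega)]
        simp only [w, Fin.val_succ]
        rw [if_neg (by omega), if_neg (by omega)]
        rfl
    rw [← hDP]
    -- the functional which inserts a column into the columns common to all minors
    let τ : ℕ → ℕ := fun r => if r < l then r + 1 else r + 2
    let T : Matrix (Fin (s + 1)) (Fin s) ℝ := Matrix.of fun k r => K (x k.castSucc) (w (τ r))
    let G : Fin (s + 1) → ℝ := fun k => (T.submatrix k.succAbove id).det
    let ell : Fin (s + 3) → ℝ := fun i => ∑ k : Fin (s + 1), (-1) ^ (k : ℕ) * A k.castSucc i * G k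
    -- Up to the sign of moving column `i` to its place `q` among the common columns `τ`, `ell i` is
    -- a minor of size `s + 1`. Hence the outer induction gives its sign for the three columns
    -- outside `τ`.
    have hell : ∀ (q : Fin (s + 1)) (e : ℕ → ℕ) (i : Fin (s + 3)), e q = i →
        (∀ r : Fin s, e (q.succAbove r) = τ r) →
        (Matrix.of fun k j : Fin (s + 1) => K (x k.castSucc) (w (e j))).det =
          (-1) ^ (q : ℕ) * ell i := by
      intro q e i hq he
      rw [Matrix.det_succ_column _ q, Finset.mul_sum]
      refine Finset.sum_congr rfl fun k _ => ?_
      have : ((Matrix.of fun k j : Fin (s + 1) => K (x k.castSucc) (w (e j))).submatrix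
          k.succAbove q.succAbove) = T.submatrix k.succAbove id := by
        ext a b
        simp [T, he]
      rw [this]
      simp only [Matrix.of_apply, hq, A, G]
      ring
    have hEpos : ∀ e : ℕ → ℕ, (∀ i, i + 1 < s + 1 → e i < e (i + 1)) → (∀ i < s + 1, e i < s + 3) →
        0 < (Matrix.of fun k j : Fin (s + 1) => K (x k.castSucc) (w (e j))).det := by
      intro e he1 he2
      exact ihm _ (fun j => w (e j)) (fun i hi => hwmono _ _ (he1 i hi) (he2 _ hi))
        (fun i hi => hwN _ (he2 i hi)) le_rfl _
        (fun a b hab => hx (Fin.castSucc_lt_castSucc_iff.2 hab))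
    have hell0 : 0 < ell 0 := by
      have h1 := hell 0 (fun j => if j < l + 1 then j else j + 1) 0 (by simp) (by
        intro r
        dsimp only [τ]; rw [Fin.succAbove_zero, Fin.val_succ]
        split_ifs <;> omega)
      have h2 := hEpos (fun j => if j < l + 1 then j else j + 1)
        (by intro i hi; split_ifs <;> omega) (by intro i hi; split_ifs <;> omega)
      rw [h1] at h2
      simpa using h2
    have hellP : 0 < (-1) ^ l * ell P := by
      have h1 := hell ⟨l, hl⟩ (fun j => j + 1) P (by simp [P]) (by
        intro r
        simp only [τ]
        by_cases hr : (r : ℕ) < l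
        · rw [Fin.succAbove_of_castSucc_lt _ _ (by simpa [Fin.lt_def] using hr), if_pos hr]
          simp
        · rw [Fin.succAbove_of_le_castSucc _ _ (by simp [Fin.le_def]; omega), if_neg hr]
          simp)
      have h2 := hEpos (fun j => j + 1) (by intro i hi; omega) (by intro i hi; omega)
      rw [h1] at h2
      exact h2
    have helll : 0 < (-1) ^ s * ell (Fin.last _) := by
      have h1 := hell (Fin.last s) (fun j => if j < l then j + 1 else j + 2) (Fin.last _) (by
          simp only [Fin.val_last]; rw [if_neg (by omega)]) (by
        intro r
        simp only [τ, Fin.succAbove_last, Fin.val_castSucc])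
      have h2 := hEpos (fun j => if j < l then j + 1 else j + 2)
        (by intro i hi; split_ifs <;> omega) (by intro i hi; split_ifs <;> omega)
      rw [h1] at h2
      simpa using h2
    have hellτ : ∀ i : Fin (s + 3), i ≠ 0 → i ≠ P → i ≠ Fin.last _ → ell i = 0 := by
      intro i h0 hP hlast
      have h0' : (i : ℕ) ≠ 0 := fun h => h0 (Fin.ext h)
      have hP' : (i : ℕ) ≠ l + 1 := fun h => hP (Fin.ext h)
      have hl' : (i : ℕ) ≠ s + 2 := fun h => hlast (Fin.ext h)
      have h1 := hell 0 (fun j => if j = 0 then i else τ (j - 1)) i (by simp) (by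
        intro r
        simp)
      rw [← mul_right_inj' (pow_ne_zero ((0 : Fin (s + 1)) : ℕ) (by norm_num : (-1 : ℝ) ≠ 0)), ← h1, mul_zero]
      let j : Fin (s + 1) := ⟨if (i : ℕ) ≤ l then i else i - 1, by split_ifs <;> omega⟩
      refine Matrix.det_zero_of_column_eq (i := 0) (j := j) ?_ ?_
      · intro h
        have := congrArg Fin.val h
        simp only [j, Fin.val_zero] at this
        split_ifs at this <;> omega
      · intro k
        simp only [Matrix.of_apply, j, τ]
        congr 2
        simp only [Fin.val_zero, if_true]
        split_ifs <;> omega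
    -- `ell` is linear in the column, so it can be applied to the cofactor relation satisfied by
    -- every row of `A`. Only the three columns outside `τ` survive.
    have hrel : ∑ i : Fin (s + 3), (-1) ^ (i : ℕ) * D i * ell i = 0 := by
      simp only [ell, Finset.mul_sum]
      rw [Finset.sum_comm]
      refine Finset.sum_eq_zero fun k _ => ?_
      have := A.sum_neg_one_pow_mul_det_succAbove k.castSucc
      rw [← mul_zero ((-1) ^ (k : ℕ) * G k), ← this, Finset.mul_sum]
      refine Finset.sum_congr rfl fun i _ => ?_
      simp only [D]
      ring
    have h0P : (0 : Fin (s + 3)) ≠ P := fun h => by simpa [P] using congrArg Fin.val h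
    have hPl : P ≠ Fin.last (s + 2) := fun h => by
      have := congrArg Fin.val h
      simp [P] at this
      omega
    have h0l : (0 : Fin (s + 3)) ≠ Fin.last (s + 2) := fun h => by simpa using congrArg Fin.val h
    rw [← Finset.sum_subset (Finset.subset_univ {0, P, Fin.last (s + 2)}) (by
      intro i _ hi
      simp only [Finset.mem_insert, Finset.mem_singleton, not_or] at hi
      rw [hellτ i hi.1 hi.2.1 hi.2.2, mul_zero]),
      Finset.sum_insert (by simp [h0P, h0l]), Finset.sum_insert (by simp [hPl]),
      Finset.sum_singleton] at hrel
    simp only [Fin.val_zero, pow_zero, one_mul, Fin.val_last, P] at hrel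
    have e1 : D 0 * ell 0 + D (Fin.last _) * ((-1) ^ s * ell (Fin.last _)) =
        D P * ((-1) ^ l * ell P) := by
      have h3 : ((-1 : ℝ)) ^ (s + 2) = (-1) ^ s := by rw [pow_add]; norm_num
      rw [h3, pow_succ] at hrel
      linear_combination hrel
    have e2 : 0 < D P * ((-1) ^ l * ell P) := by
      rw [← e1]
      positivity
    exact (pos_iff_pos_of_mul_pos e2).2 hellP

/-! ### Total positivity of the bicanonical system -/

theorem HasZeros.of_endpoints {f : ℝ → ℝ} {β : ℝ} (hβ : 0 < β) {a b k : ℕ}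
    (h0 : VanishesToOrder f 0 a) (h1 : VanishesToOrder f β b) (Z : Finset ℝ)
    (hZ : ∀ z ∈ Z, z ∈ Set.Ioo 0 β ∧ f z = 0) (hk : k ≤ a + b + Z.card) :
    HasZeros f (Set.Icc 0 β) k := by
  have h0Z : 0 ∉ Z := fun h => lt_irrefl _ (hZ 0 h).1.1
  have hβZ : β ∉ Z := fun h => lt_irrefl _ (hZ β h).1.2
  refine ⟨insert 0 (insert β Z), fun z => if z = 0 then a else if z = β then b else 1, ?_, ?_, ?_⟩
  · intro z hz
    simp only [Finset.coe_insert, Set.mem_insert_iff, Finset.mem_coe] at hz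
    rcases hz with rfl | rfl | hz
    · exact ⟨le_rfl, hβ.le⟩
    · exact ⟨hβ.le, le_rfl⟩
    · exact ⟨(hZ z hz).1.1.le, (hZ z hz).1.2.le⟩
  · intro z hz
    dsimp only
    split_ifs with e1 e2
    · rwa [e1]
    · rwa [e2]
    · intro j hj
      obtain rfl : j = 0 := by omega
      simpa using (hZ z (by simpa [e1, e2] using hz)).2
  · rw [Finset.sum_insert (by simp [hβ.ne, h0Z]), Finset.sum_insert hβZ]
    rw [Finset.sum_congr rfl (g := fun _ => 1) fun z hz => by
      rw [if_neg (ne_of_mem_of_not_mem hz h0Z), if_neg (ne_of_mem_of_not_mem hz hβZ)]]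
    simp [hβ.ne']
    omega

theorem eventually_pos_of_iteratedDeriv_pos (q : ℕ) : ∀ {f : ℝ → ℝ}, ContDiff ℝ ∞ f →
    VanishesToOrder f 0 q → 0 < iteratedDeriv q f 0 → ∀ᶠ x in 𝓝[>] 0, 0 < f x := by
  induction q with
  | zero =>
    intro f hf _ hpos
    rw [iteratedDeriv_zero] at hpos
    exact (hf.continuous.continuousAt.eventually (lt_mem_nhds hpos)).filter_mono
      nhdsWithin_le_nhds
  | succ q ih =>
    intro f hf hV hpos
    rw [VanishesToOrder.succ_iff] at hV
    rw [iteratedDeriv_succ'] at hpos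
    have hd := ih (contDiff_infty_iff_deriv.1 hf).2 hV.2 hpos
    obtain ⟨δ, hδ, hδ'⟩ := mem_nhdsGT_iff_exists_Ioo_subset.1 hd
    filter_upwards [Ioo_mem_nhdsGT hδ] with x hx
    have hmono : StrictMonoOn f (Set.Icc 0 x) := by
      refine strictMonoOn_of_deriv_pos (convex_Icc 0 x) hf.continuous.continuousOn fun y hy => ?_
      rw [interior_Icc] at hy
      exact hδ' ⟨hy.1, hy.2.trans hx.2⟩
    rw [← hV.1]
    exact hmono ⟨le_rfl, hx.1.le⟩ ⟨hx.1.le, le_rfl⟩ hx.1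

/-- The leading derivative gives the sign just to the right of `0`, and a function without zeros
keeps its sign. -/
theorem pos_of_iteratedDeriv_pos {f : ℝ → ℝ} (hf : ContDiff ℝ ∞ f) {q : ℕ}
    (hV : VanishesToOrder f 0 q) (hpos : 0 < iteratedDeriv q f 0) {a : ℝ} (ha : 0 < a)
    (hne : ∀ x ∈ Set.Ioc 0 a, f x ≠ 0) : 0 < f a := by
  by_contra hcon
  obtain ⟨y, hy, hya⟩ := ((eventually_pos_of_iteratedDeriv_pos q hf hV hpos).and
    (Ioo_mem_nhdsGT ha)).exists
  obtain ⟨z, hz, hz0⟩ := intermediate_value_Icc' hya.2.le hf.continuous.continuousOn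
    ⟨not_lt.1 hcon, hy.le⟩
  exact hne z ⟨hya.1.trans_le hz.1, hz.2⟩ hz0

namespace IsBicanonical

variable {n : ℕ} {p : Polynomial ℝ} {β : ℝ} {v : Fin (n + 1) → ℝ → ℝ}

theorem vanishes_left (h : IsBicanonical β v) (i : Fin (n + 1)) : VanishesToOrder (v i) 0 i :=
  (h.1 i).1

theorem vanishes_right (h : IsBicanonical β v) (i : Fin (n + 1)) :
    VanishesToOrder (v i) β (n - i) :=
  fun j hj => h.2 i j (by omega)

/-- The minors of a bicanonical system with consecutive columns are positive in `(0, β)`. -/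
theorem consecutive_minors_pos (hβ : 0 < β) (hb : IsBicanonical β v)
    (hv : ∀ i, v i ∈ solutionSpace p)
    (hZ : ∀ f ∈ solutionSpace p, HasZeros f (Set.Icc 0 β) (n + 1) → f = 0)
    (m : ℕ) : ∀ x : Fin m → Set.Ioo 0 β, StrictMono x → ∀ c, c + m ≤ n + 1 →
    0 < (Matrix.of fun k l : Fin m => v (Fin.ofNat (n + 1) (c + l)) (x k)).det := by
  have hval : ∀ i, i < n + 1 → (Fin.ofNat (n + 1) i : ℕ) = i := fun i hi => Nat.mod_eq_of_lt hi
  induction m with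
  | zero => intros; simp
  | succ m ih =>
    intro x hx c hc
    -- The first node becomes a variable `t`. The determinant `F` has `c` zeros at `0`, `n - (c +
    -- m)` at `β` and the other `m` nodes, already `n` in all; one more in `(0, x 0]` would make it
    -- vanish identically. Its `c`-th derivative at `0` is the smaller minor `M 0`, which is
    -- positive by induction.
    let B : ℝ → Matrix (Fin (m + 1)) (Fin (m + 1)) ℝ := fun t => Matrix.of fun k l =>
      v (Fin.ofNat (n + 1) (c + l)) (Fin.cases t (fun k => (x k.succ : ℝ)) k)
    let M : Fin (m + 1) → ℝ := fun l =>
      (Matrix.of fun k j : Fin m => v (Fin.ofNat (n + 1) (c + l.succAbove j)) (x k.succ)).det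
    let F : ℝ → ℝ := fun t => ∑ l : Fin (m + 1),
      ((-1) ^ (l : ℕ) * M l) * v (Fin.ofNat (n + 1) (c + l)) t
    have hFB : ∀ t, F t = (B t).det := by
      intro t
      rw [Matrix.det_succ_row_zero]
      refine Finset.sum_congr rfl fun l _ => ?_
      have : (B t).submatrix Fin.succ l.succAbove = Matrix.of fun k j : Fin m =>
          v (Fin.ofNat (n + 1) (c + l.succAbove j)) (x k.succ) := by
        ext k j
        simp [B]
      rw [this]
      simp only [B, M, Matrix.of_apply, Fin.cases_zero]
      ring
    have hFS : F ∈ solutionSpace p := solutionSpace.sum_mul_mem _ _ _ fun l _ => hv _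
    have hjet : ∀ j u, iteratedDeriv j F u = ∑ l : Fin (m + 1),
        ((-1) ^ (l : ℕ) * M l) * iteratedDeriv j (v (Fin.ofNat (n + 1) (c + l))) u := fun j u =>
      iteratedDeriv_sum_mul _ _ _ (fun l _ => (hv _).1) j u
    have hF0 : VanishesToOrder F 0 c := by
      intro j hj
      rw [hjet]
      refine Finset.sum_eq_zero fun l _ => ?_
      rw [hb.vanishes_left _ j (by rw [hval _ (by omega)]; omega), mul_zero]
    have hFβ : VanishesToOrder F β (n - (c + m)) := by
      intro j hj
      rw [hjet]
      refine Finset.sum_eq_zero fun l _ => ?_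
      rw [hb.vanishes_right _ j (by rw [hval _ (by omega)]; omega), mul_zero]
    have hM0 : 0 < M 0 := by
      have := ih (fun k => x k.succ) (fun a b hab => hx (Fin.succ_lt_succ_iff.2 hab)) (c + 1)
        (by omega)
      convert this using 7
      simp
      ring
    have hFc : 0 < iteratedDeriv c F 0 := by
      rw [hjet, Fin.sum_univ_succ, Finset.sum_eq_zero, add_zero]
      · have := (hb.1 (Fin.ofNat (n + 1) c)).2
        rw [hval c (by omega)] at this
        simpa only [Fin.val_zero, add_zero, pow_zero, one_mul, this, mul_one] using hM0
      · intro l _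
        rw [hb.vanishes_left _ c (by rw [hval _ (by rw [Fin.val_succ]; omega)]; simp), mul_zero]
    have hpos : 0 < F (x 0) := by
      refine pos_of_iteratedDeriv_pos hFS.1 hF0 hFc (x 0).2.1 fun t ht hFt => ?_
      have htx : ∀ k : Fin m, t < x k.succ := fun k =>
        ht.2.trans_lt (hx (Fin.succ_pos k))
      let e : Fin m ↪ ℝ := ⟨fun k => x k.succ, fun a b hab =>
        Fin.succ_injective _ (hx.injective (Subtype.ext hab))⟩
      have htn : t ∉ Finset.univ.map e := by
        simp only [Finset.mem_map, Finset.mem_univ, true_and, not_exists]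
        exact fun k => (htx k).ne'
      have hz : HasZeros F (Set.Icc 0 β) (n + 1) := by
        refine HasZeros.of_endpoints hβ hF0 hFβ (insert t (Finset.univ.map e)) ?_ ?_
        · intro z hz
          simp only [Finset.mem_insert, Finset.mem_map, Finset.mem_univ, true_and] at hz
          rcases hz with rfl | ⟨k, rfl⟩
          · exact ⟨⟨ht.1, ht.2.trans_lt (x 0).2.2⟩, hFt⟩
          · refine ⟨(x k.succ).2, ?_⟩
            rw [hFB]
            refine Matrix.det_zero_of_row_eq (Fin.succ_ne_zero k).symm ?_
            ext l
            simp only [B, Matrix.of_apply, Fin.cases_zero, Fin.cases_succ]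
            rfl
        · rw [Finset.card_insert_of_notMem htn]
          simp
          omega
      rw [hZ F hFS hz] at hFc
      simp at hFc
    rw [hFB] at hpos
    have hB : (Matrix.of fun k l : Fin (m + 1) => v (Fin.ofNat (n + 1) (c + l)) (x k)) =
        B (x 0) := by
      ext k l
      cases k using Fin.cases <;> rfl
    rwa [hB]

theorem minors_pos (hβ : 0 < β) (hb : IsBicanonical β v) (hv : ∀ i, v i ∈ solutionSpace p)
    (hZ : ∀ f ∈ solutionSpace p, HasZeros f (Set.Icc 0 β) (n + 1) → f = 0)
    {m : ℕ} {x : Fin m → ℝ} (hx : StrictMono x) (hxI : ∀ k, x k ∈ Set.Ioo 0 β)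
    {c : Fin m → Fin (n + 1)} (hc : StrictMono c) :
    0 < (Matrix.of fun k l => v (c l) (x k)).det := by
  have := minors_pos_of_consecutive (N := n + 1)
    (fun (y : Set.Ioo 0 β) j => v (Fin.ofNat (n + 1) j) y)
    (consecutive_minors_pos hβ hb hv hZ) m _ (fun i => if h : i < m then c ⟨i, h⟩ else 0)
    (fun i hi => by
      rw [dif_pos hi, dif_pos (by omega)]
      exact hc (by simp [Fin.lt_def]))
    (fun i hi => by rw [dif_pos hi]; exact (c ⟨i, hi⟩).2) le_rfl (fun k => ⟨x k, hxI k⟩)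
    (fun a b hab => hx hab)
  convert this using 3
  ext k l
  simp

/-- Contracting the nodes towards the midpoint `β / 2` puts them in the open interval, where minors
are positive; the closed interval follows in the limit. -/
theorem isTotallyPositiveOn (hβ : 0 < β) (hb : IsBicanonical β v)
    (hv : ∀ i, v i ∈ solutionSpace p)
    (hZ : ∀ f ∈ solutionSpace p, HasZeros f (Set.Icc 0 β) (n + 1) → f = 0) :
    IsTotallyPositiveOn β v := by
  intro m x c hx hc hxI
  let y : ℝ → Fin m → ℝ := fun ε k => ε * (β / 2) + (1 - ε) * x k
  have hcont : Continuous fun ε => (Matrix.of fun k l => v (c l) (y ε k)).det := by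
    refine Continuous.matrix_det (continuous_matrix fun k l => ?_)
    exact (hv (c l)).1.continuous.comp (by fun_prop)
  have hlim : Filter.Tendsto (fun ε => (Matrix.of fun k l => v (c l) (y ε k)).det) (𝓝[>] 0)
      (𝓝 (Matrix.of fun k l => v (c l) (x k)).det) := by
    have := hcont.tendsto 0
    simp only [y, zero_mul, sub_zero, one_mul, zero_add] at this
    exact this.mono_left nhdsWithin_le_nhds
  refine ge_of_tendsto hlim ?_
  filter_upwards [Ioo_mem_nhdsGT (show (0 : ℝ) < 1 by norm_num)] with ε hε
  refine (minors_pos hβ hb hv hZ (fun a b hab => ?_) (fun k => ⟨?_, ?_⟩) hc).le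
  · have := mul_lt_mul_of_pos_left (hx hab) (sub_pos.2 hε.2)
    simp only [y]
    linarith
  · have := mul_nonneg (sub_pos.2 hε.2).le (hxI k).1
    have := mul_pos hε.1 hβ
    simp only [y]
    linarith
  · have := mul_le_mul_of_nonneg_left (hxI k).2 (sub_pos.2 hε.2).le
    have := mul_pos hε.1 hβ
    simp only [y]
    linarith

theorem pos_of_mem_Ioo (hβ : 0 < β) (hb : IsBicanonical β v) (hv : ∀ i, v i ∈ solutionSpace p)
    (hZ : ∀ f ∈ solutionSpace p, HasZeros f (Set.Icc 0 β) (n + 1) → f = 0)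
    (i : Fin (n + 1)) {x : ℝ} (hx : x ∈ Set.Ioo 0 β) : 0 < v i x := by
  have := minors_pos hβ hb hv hZ (x := fun _ : Fin 1 => x) (c := fun _ => i)
    (Subsingleton.strictMono _) (fun _ => hx) (Subsingleton.strictMono _)
  simpa using this

end IsBicanonical

/-! ### Triangular factorizations and bases -/

/-- A Doolittle factorization of a lower triangular matrix has a diagonal second factor. -/
theorem IsDoolittle.eq_diagonal {m : ℕ} {A L U : Matrix (Fin m) (Fin m) ℝ}
    (h : IsDoolittle A L U) (hA : ∀ i j, i < j → A i j = 0) :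
    U = Matrix.diagonal fun k => A k k := by
  obtain ⟨hLU, hL1, hL, hU, -⟩ := h
  have hLt : L.BlockTriangular OrderDual.toDual := fun i j hij => hL i j hij
  have hLdet : L.det = 1 := by
    rw [Matrix.det_of_isLowerTriangular L hLt]
    simp [hL1]
  let _ : Invertible L := L.invertibleOfIsUnitDet (by simp [hLdet])
  have hUe : U = L⁻¹ * A := by
    rw [← hLU, ← Matrix.mul_assoc, Matrix.nonsing_inv_mul _ (by simp [hLdet]), Matrix.one_mul]
  have hUt : U.BlockTriangular OrderDual.toDual := by
    rw [hUe]
    exact (Matrix.blockTriangular_inv_of_blockTriangular hLt).mul fun i j hij => hA i j hij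
  have hUd : ∀ i j, i ≠ j → U i j = 0 := fun i j hij => by
    rcases lt_or_gt_of_ne hij with h | h
    · exact hUt h
    · exact hU i j h
  ext i j
  by_cases hij : i = j
  · subst hij
    rw [Matrix.diagonal_apply_eq, ← hLU, Matrix.mul_apply, Finset.sum_eq_single i, hL1, one_mul]
    · exact fun k _ hk => by rw [hUd k i hk, mul_zero]
    · simp
  · rw [Matrix.diagonal_apply_ne _ hij, hUd i j hij]

/-- The coefficient of `v i` in `bFun v L U i` when `U` is diagonal. -/
noncomputable def bCoeff {n : ℕ} (L U : Matrix (Fin (n + 1)) (Fin (n + 1)) ℝ) (i : Fin (n + 1)) :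
    ℝ :=
  L⁻¹ (Fin.rev i) 0 * U⁻¹ (Fin.rev i) (Fin.rev i)

theorem linearIndependent_of_triangular_jets {n : ℕ} {w : Fin (n + 1) → ℝ → ℝ}
    (hw : ∀ i, ContDiff ℝ ∞ (w i)) (h0 : ∀ i : Fin (n + 1), VanishesToOrder (w i) 0 i)
    (h1 : ∀ i : Fin (n + 1), iteratedDeriv i (w i) 0 ≠ 0) : LinearIndependent ℝ w := by
  rw [Fintype.linearIndependent_iff]
  intro a ha i
  have hsum : (fun x => ∑ i, a i * w i x) = fun _ => 0 := by
    ext x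
    simpa using congrFun ha x
  induction i using WellFoundedLT.induction with
  | _ i ih =>
    have := iteratedDeriv_sum_mul Finset.univ a w (fun i _ => hw i) i 0
    rw [hsum, Finset.sum_eq_single i] at this
    · simpa [h1 i] using this.symm
    · intro j _ hj
      rcases lt_or_gt_of_ne hj with h | h
      · rw [ih j h, zero_mul]
      · rw [h0 j i h, mul_zero]
    · simp

theorem eq_of_sum_mul_eq {n : ℕ} {w : Fin (n + 1) → ℝ → ℝ} (hw : LinearIndependent ℝ w)
    {a b : Fin (n + 1) → ℝ} (h : ∀ x, ∑ i, a i * w i x = ∑ i, b i * w i x) : a = b := by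
  refine hw.fintypeLinearCombination_injective ?_
  ext x
  simpa [Fintype.linearCombination_apply] using h x

theorem LinearIndependent.isBasisOf {n : ℕ} {S : Submodule ℝ (ℝ → ℝ)} {w : Fin (n + 1) → ℝ → ℝ}
    (hw : LinearIndependent ℝ w) (hS : Module.finrank ℝ S = n + 1) (hwS : ∀ i, w i ∈ S) :
    IsBasisOf S w := by
  have : FiniteDimensional ℝ S := FiniteDimensional.of_finrank_eq_succ hS
  refine ⟨hw, Submodule.eq_of_le_of_finrank_eq (Submodule.span_le.2 ?_) ?_⟩
  · rintro _ ⟨i, rfl⟩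
    exact hwS i
  · rw [finrank_span_eq_card hw, hS, Fintype.card_fin]

theorem IsBasisOf.mem {n : ℕ} {S : Submodule ℝ (ℝ → ℝ)} {w : Fin (n + 1) → ℝ → ℝ}
    (hw : IsBasisOf S w) (i : Fin (n + 1)) : w i ∈ S :=
  hw.2 ▸ Submodule.subset_span ⟨i, rfl⟩

theorem solutionSpace.eq_zero_of_endpoints {n : ℕ} {p : Polynomial ℝ} {β : ℝ} (hβ : 0 < β)
    (hZ : ∀ f ∈ solutionSpace p, HasZeros f (Set.Icc 0 β) (n + 1) → f = 0) {f : ℝ → ℝ}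
    (hf : f ∈ solutionSpace p) {a b : ℕ} (h0 : VanishesToOrder f 0 a)
    (h1 : VanishesToOrder f β b) (hab : n + 1 ≤ a + b) : f = 0 :=
  hZ f hf (HasZeros.of_endpoints hβ h0 h1 ∅ (by simp) (by simpa using hab))

/-- For each `i` the `i + 1` conditions at `0` and `n - i` at `β` form a unisolvent Hermite problem.
-/
theorem solutionSpace.exists_isBicanonical {n : ℕ} {p : Polynomial ℝ} {β : ℝ} (hβ : 0 < β)
    (hS : Module.finrank ℝ (solutionSpace p) = n + 1)
    (hZ : ∀ f ∈ solutionSpace p, HasZeros f (Set.Icc 0 β) (n + 1) → f = 0) :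
    ∃ v : Fin (n + 1) → ℝ → ℝ, (∀ i, v i ∈ solutionSpace p) ∧ IsBicanonical β v := by
  have h := fun i : Fin (n + 1) => (existsUnique_interpolation hS
    (ι := Fin (i + 1) ⊕ Fin (n - i)) (by simp; omega) (Sum.elim (fun j => (j : ℕ)) fun j => (j : ℕ))
    (Sum.elim (fun _ => 0) fun _ => β) (fun f hf h => eq_zero_of_endpoints hβ hZ hf
      (a := i + 1) (b := n - i) (fun j hj => h (Sum.inl ⟨j, hj⟩)) (fun j hj => h (Sum.inr ⟨j, hj⟩))
      (by omega))
    (Sum.elim (fun j => if (j : ℕ) = i then 1 else 0) fun _ => 0)).exists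
  choose v hv hvj using h
  refine ⟨v, hv, fun i => ⟨fun j hj => ?_, ?_⟩, fun i j hij => ?_⟩
  · simpa [hj.ne] using hvj i (Sum.inl ⟨j, by omega⟩)
  · simpa using hvj i (Sum.inl ⟨i, by omega⟩)
  · simpa using hvj i (Sum.inr ⟨j, by omega⟩)

/-! ### The bicanonical system and its reversed Wronskian at the right end -/

namespace IsBicanonical

variable {n : ℕ} {p : Polynomial ℝ} {β : ℝ} {v : Fin (n + 1) → ℝ → ℝ}

theorem linearIndependent (hb : IsBicanonical β v) (hv : ∀ i, v i ∈ solutionSpace p) :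
    LinearIndependent ℝ v :=
  linearIndependent_of_triangular_jets (fun i => (hv i).1) hb.vanishes_left
    fun i => by rw [(hb.1 i).2]; exact one_ne_zero

/-- A solution with `i` zeros at `0` and `n - i` zeros at `β` is a multiple of `v i`. -/
theorem eq_mul (hβ : 0 < β) (hb : IsBicanonical β v) (hv : ∀ i, v i ∈ solutionSpace p)
    (hZ : ∀ f ∈ solutionSpace p, HasZeros f (Set.Icc 0 β) (n + 1) → f = 0) {f : ℝ → ℝ}
    (hf : f ∈ solutionSpace p) (i : Fin (n + 1)) (h0 : VanishesToOrder f 0 i)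
    (h1 : VanishesToOrder f β (n - i)) : f = fun x => iteratedDeriv i f 0 * v i x := by
  have hg : (fun x => iteratedDeriv i f 0 * v i x) ∈ solutionSpace p :=
    Submodule.smul_mem _ (iteratedDeriv i f 0) (hv i)
  have hjet : ∀ j u, iteratedDeriv j (f - fun x => iteratedDeriv i f 0 * v i x) u =
      iteratedDeriv j f u - iteratedDeriv i f 0 * iteratedDeriv j (v i) u := by
    intro j u
    rw [iteratedDeriv_sub (hf.1.of_le (by exact_mod_cast le_top)).contDiffAt
      (hg.1.of_le (by exact_mod_cast le_top)).contDiffAt, iteratedDeriv_const_mul_field]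
  rw [← sub_eq_zero]
  refine solutionSpace.eq_zero_of_endpoints hβ hZ (Submodule.sub_mem _ hf hg) (a := i + 1)
    (b := n - i) (fun j hj => ?_) (fun j hj => ?_) (by omega)
  · rw [hjet]
    rcases Nat.lt_succ_iff_lt_or_eq.1 hj with h | rfl
    · rw [h0 j h, hb.vanishes_left i j h, mul_zero, sub_zero]
    · rw [(hb.1 i).2, mul_one, sub_self]
  · rw [hjet, h1 j hj, hb.vanishes_right i j hj, mul_zero, sub_zero]

theorem unique (hβ : 0 < β) (hb : IsBicanonical β v) (hv : ∀ i, v i ∈ solutionSpace p)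
    (hZ : ∀ f ∈ solutionSpace p, HasZeros f (Set.Icc 0 β) (n + 1) → f = 0)
    {w : Fin (n + 1) → ℝ → ℝ} (hbw : IsBicanonical β w) (hw : ∀ i, w i ∈ solutionSpace p) :
    w = v := by
  ext i x
  rw [hb.eq_mul hβ hv hZ (hw i) i (hbw.vanishes_left i) (hbw.vanishes_right i), (hbw.1 i).2]
  exact one_mul _

/-- Column `j` belongs to `v (n - j)`, which has a `j`-fold zero at `β`. This triangularity is what
makes `U` diagonal. -/
theorem wronskianMatrix_eq_zero (hb : IsBicanonical β v) (i j : Fin (n + 1)) (hij : i < j) :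
    wronskianMatrix (fun k => v (Fin.rev k)) β i j = 0 :=
  hb.vanishes_right (Fin.rev j) i (by rw [Fin.val_rev, Fin.lt_def] at *; omega)

/-- A zero diagonal entry would give `v (n - k)` one more zero at `β`, hence `n + 1` zeros
altogether. -/
theorem wronskianMatrix_diag_ne_zero (hβ : 0 < β) (hb : IsBicanonical β v)
    (hv : ∀ i, v i ∈ solutionSpace p)
    (hZ : ∀ f ∈ solutionSpace p, HasZeros f (Set.Icc 0 β) (n + 1) → f = 0) (k : Fin (n + 1)) :
    wronskianMatrix (fun k => v (Fin.rev k)) β k k ≠ 0 := by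
  intro h
  have h' : iteratedDeriv k (v (Fin.rev k)) β = 0 := h
  have hz := solutionSpace.eq_zero_of_endpoints hβ hZ (hv (Fin.rev k)) (hb.vanishes_left _)
    (b := k + 1) (fun j hj => by
      rcases Nat.lt_succ_iff_lt_or_eq.1 hj with h2 | rfl
      · exact hb.vanishes_right (Fin.rev k) j (by rw [Fin.val_rev]; omega)
      · exact h') (by rw [Fin.val_rev]; omega)
  have := (hb.1 (Fin.rev k)).2
  rw [hz] at this
  simp at this

theorem existsUnique_doolittle (hβ : 0 < β) (hb : IsBicanonical β v)
    (hv : ∀ i, v i ∈ solutionSpace p)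
    (hZ : ∀ f ∈ solutionSpace p, HasZeros f (Set.Icc 0 β) (n + 1) → f = 0) :
    ∃! LU : Matrix (Fin (n + 1)) (Fin (n + 1)) ℝ × Matrix (Fin (n + 1)) (Fin (n + 1)) ℝ,
      IsDoolittle (wronskianMatrix (fun k => v (Fin.rev k)) β) LU.1 LU.2 := by
  set A := wronskianMatrix (fun k => v (Fin.rev k)) β with hA
  have hne : ∀ k, A k k ≠ 0 := hb.wronskianMatrix_diag_ne_zero hβ hv hZ
  have hlow : ∀ i j, i < j → A i j = 0 := hb.wronskianMatrix_eq_zero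
  have hdiag : (Matrix.diagonal fun k => (A k k)⁻¹) * (Matrix.diagonal fun k => A k k) = 1 := by
    rw [Matrix.diagonal_mul_diagonal, ← Matrix.diagonal_one]
    exact congrArg _ (funext fun k => inv_mul_cancel₀ (hne k))
  have hdiag' := mul_eq_one_comm.1 hdiag
  refine ⟨(A * Matrix.diagonal fun k => (A k k)⁻¹, Matrix.diagonal fun k => A k k),
    ⟨?_, fun i => ?_, fun i j hij => ?_, fun i j hij => ?_, ?_⟩, ?_⟩
  · simp only
    rw [Matrix.mul_assoc, hdiag, Matrix.mul_one]
  · simp [hne i]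
  · simp [hlow i j hij]
  · exact Matrix.diagonal_apply_ne _ hij.ne'
  · simp only
    rw [Matrix.det_diagonal]
    exact Finset.prod_ne_zero_iff.2 fun k _ => hne k
  · rintro ⟨L, U⟩ hLU
    have hU : U = _ := hLU.eq_diagonal hlow
    have hL : L = A * Matrix.diagonal fun k => (A k k)⁻¹ := by
      have h1 : L * U = A := hLU.1
      rw [hU] at h1
      have h2 := congrArg (fun M => M * Matrix.diagonal fun k => (A k k)⁻¹) h1
      simpa only [Matrix.mul_assoc, hdiag', Matrix.mul_one] using h2
    rw [hU, hL]

/-! ### The constructed system as a rescaling of the bicanonical one -/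

theorem doolittle_inv (hb : IsBicanonical β v) {L U : Matrix (Fin (n + 1)) (Fin (n + 1)) ℝ}
    (hLU : IsDoolittle (wronskianMatrix (fun k => v (Fin.rev k)) β) L U) :
    U⁻¹ = Matrix.diagonal fun k => U⁻¹ k k := by
  have hU := hLU.eq_diagonal hb.wronskianMatrix_eq_zero
  rw [hU, Matrix.inv_diagonal]
  simp

theorem bTilde_eq (hb : IsBicanonical β v) {L U : Matrix (Fin (n + 1)) (Fin (n + 1)) ℝ}
    (hLU : IsDoolittle (wronskianMatrix (fun k => v (Fin.rev k)) β) L U) (i : Fin (n + 1)) :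
    bTilde v U i = fun x => U⁻¹ (Fin.rev i) (Fin.rev i) * v i x := by
  ext x
  rw [bTilde, hb.doolittle_inv hLU, Matrix.vecMul_diagonal, Matrix.diagonal_apply_eq, Fin.rev_rev,
    mul_comm]

theorem bFun_eq (hb : IsBicanonical β v) {L U : Matrix (Fin (n + 1)) (Fin (n + 1)) ℝ}
    (hLU : IsDoolittle (wronskianMatrix (fun k => v (Fin.rev k)) β) L U) (i : Fin (n + 1)) :
    bFun v L U i = fun x => bCoeff L U i * v i x := by
  ext x
  rw [bFun, hb.bTilde_eq hLU, bCoeff, mul_assoc]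

theorem sum_bCoeff_mul (hdeg : p.natDegree = n + 1) (hroot : p.eval 0 = 0)
    (hb : IsBicanonical β v) (hv : ∀ i, v i ∈ solutionSpace p)
    {L U : Matrix (Fin (n + 1)) (Fin (n + 1)) ℝ}
    (hLU : IsDoolittle (wronskianMatrix (fun k => v (Fin.rev k)) β) L U) (x : ℝ) :
    ∑ i, bCoeff L U i * v i x = 1 := by
  have hg := solutionSpace.sum_mul_mem (p := p) Finset.univ (bCoeff L U) v fun i _ => hv i
  have h1 := solutionSpace.one_mem hroot
  have hLdet : IsUnit L.det := by
    rw [Matrix.det_of_isLowerTriangular L fun i j hij => hLU.2.2.1 i j hij]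
    simp [hLU.2.1]
  have hLe : wronskianMatrix (fun k => v (Fin.rev k)) β * U⁻¹ = L := by
    rw [← hLU.1, Matrix.mul_assoc, Matrix.mul_nonsing_inv _ (isUnit_iff_ne_zero.2 hLU.2.2.2.2),
      Matrix.mul_one]
  have key := solutionSpace.eq_zero_of_vanishesToOrder hdeg (Submodule.sub_mem _ hg h1) (u := β)
    (fun j hj => by
      rw [iteratedDeriv_sub (hg.1.of_le (by exact_mod_cast le_top)).contDiffAt
        (h1.1.of_le (by exact_mod_cast le_top)).contDiffAt,
        iteratedDeriv_sum_mul _ _ _ fun i _ => (hv i).1, sub_eq_zero, ← Equiv.sum_comp Fin.revPerm]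
      -- The first column of `L * L⁻¹ = 1`. As `L` is the Wronskian matrix times the diagonal `U⁻¹`,
      -- it says that the sum and the constant `1` have the same jet at `β`.
      have hone := congrFun (congrFun (Matrix.mul_nonsing_inv L hLdet) ⟨j, hj⟩) 0
      rw [Matrix.mul_apply] at hone
      rw [iteratedDeriv_const]
      convert hone using 1
      · refine Finset.sum_congr rfl fun k _ => ?_
        have hLk : L ⟨j, hj⟩ k =
            wronskianMatrix (fun k => v (Fin.rev k)) β ⟨j, hj⟩ k * U⁻¹ k k := by
          conv_lhs => rw [← hLe]
          rw [hb.doolittle_inv hLU, Matrix.mul_diagonal, Matrix.diagonal_apply_eq]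
        rw [hLk, bCoeff, Fin.revPerm_apply, Fin.rev_rev, wronskianMatrix, Matrix.of_apply]
        ring
      · simp [Matrix.one_apply, Fin.ext_iff])
  exact sub_eq_zero.1 (congrFun key x)

/-- Reflection swaps the zero orders at the two ends, so the reflected `v i` is a multiple of `v (n
- i)`; the factor is its derivative of order `n - i` at `0`. -/
theorem comp_const_sub_eq (hβ : 0 < β)
    (hpar : p.comp (-Polynomial.X) = p ∨ p.comp (-Polynomial.X) = -p)
    (hb : IsBicanonical β v) (hv : ∀ i, v i ∈ solutionSpace p)
    (hZ : ∀ f ∈ solutionSpace p, HasZeros f (Set.Icc 0 β) (n + 1) → f = 0) (i : Fin (n + 1))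
    (x : ℝ) : v i (β - x) =
      ((-1) ^ (Fin.rev i : ℕ) * iteratedDeriv (Fin.rev i : ℕ) (v i) β) * v (Fin.rev i) x := by
  have h := hb.eq_mul hβ hv hZ (solutionSpace.comp_const_sub_mem hpar (hv i) β) (Fin.rev i)
    (VanishesToOrder.comp_const_sub (by
      rw [sub_zero]
      exact (hb.vanishes_right i).mono (by rw [Fin.val_rev]; omega)))
    (VanishesToOrder.comp_const_sub (by
      rw [sub_self]
      exact (hb.vanishes_left i).mono (by rw [Fin.val_rev]; omega)))
  rw [congrFun h x, iteratedDeriv_comp_const_sub]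
  simp

/-- The reflection factor is a quotient of two positive values at the midpoint. -/
theorem right_pos (hβ : 0 < β)
    (hpar : p.comp (-Polynomial.X) = p ∨ p.comp (-Polynomial.X) = -p)
    (hb : IsBicanonical β v) (hv : ∀ i, v i ∈ solutionSpace p)
    (hZ : ∀ f ∈ solutionSpace p, HasZeros f (Set.Icc 0 β) (n + 1) → f = 0) (i : Fin (n + 1)) :
    0 < (-1 : ℝ) ^ (Fin.rev i : ℕ) * iteratedDeriv (Fin.rev i : ℕ) (v i) β := by
  have h1 := hb.pos_of_mem_Ioo hβ hv hZ i (x := β - β / 2) ⟨by linarith, by linarith⟩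
  have h2 := hb.pos_of_mem_Ioo hβ hv hZ (Fin.rev i) (x := β / 2) ⟨by linarith, by linarith⟩
  rw [hb.comp_const_sub_eq hβ hpar hv hZ] at h1
  exact (pos_iff_pos_of_mul_pos h1).2 h2

/-- Reflecting the partition of unity expands `1` in the same basis again, so the coefficients must
agree. -/
theorem bFun_comp_const_sub (hβ : 0 < β) (hdeg : p.natDegree = n + 1)
    (hpar : p.comp (-Polynomial.X) = p ∨ p.comp (-Polynomial.X) = -p) (hroot : p.eval 0 = 0)
    (hb : IsBicanonical β v) (hv : ∀ i, v i ∈ solutionSpace p)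
    (hZ : ∀ f ∈ solutionSpace p, HasZeros f (Set.Icc 0 β) (n + 1) → f = 0)
    {L U : Matrix (Fin (n + 1)) (Fin (n + 1)) ℝ}
    (hLU : IsDoolittle (wronskianMatrix (fun k => v (Fin.rev k)) β) L U) (i : Fin (n + 1)) :
    (fun x => bFun v L U (Fin.rev i) (β - x)) = bFun v L U i := by
  have hsum := hb.sum_bCoeff_mul hdeg hroot hv hLU
  have key : (fun i => bCoeff L U (Fin.rev i) * ((-1) ^ (Fin.rev (Fin.rev i) : ℕ) *
      iteratedDeriv (Fin.rev (Fin.rev i) : ℕ) (v (Fin.rev i)) β)) = bCoeff L U := by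
    refine eq_of_sum_mul_eq (hb.linearIndependent hv) fun x => ?_
    refine Eq.trans ?_ ((hsum (β - x)).trans (hsum x).symm)
    rw [← Equiv.sum_comp Fin.revPerm fun i => bCoeff L U i * v i (β - x)]
    refine Finset.sum_congr rfl fun i _ => ?_
    rw [Fin.revPerm_apply, hb.comp_const_sub_eq hβ hpar hv hZ (Fin.rev i) x]
    simp only [Fin.rev_rev]
    ring
  ext x
  rw [hb.bFun_eq hLU, hb.bFun_eq hLU]
  beta_reduce
  rw [hb.comp_const_sub_eq hβ hpar hv hZ, ← congrFun key i]
  simp only [Fin.rev_rev]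
  ring

theorem isNormalizedBBasis_bFun (hβ : 0 < β) (hdeg : p.natDegree = n + 1)
    (hpar : p.comp (-Polynomial.X) = p ∨ p.comp (-Polynomial.X) = -p) (hroot : p.eval 0 = 0)
    (hS : Module.finrank ℝ (solutionSpace p) = n + 1)
    (hb : IsBicanonical β v) (hv : ∀ i, v i ∈ solutionSpace p)
    (hZ : ∀ f ∈ solutionSpace p, HasZeros f (Set.Icc 0 β) (n + 1) → f = 0)
    {L U : Matrix (Fin (n + 1)) (Fin (n + 1)) ℝ}
    (hLU : IsDoolittle (wronskianMatrix (fun k => v (Fin.rev k)) β) L U)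
    (hpos : ∀ i, 0 < bCoeff L U i) :
    IsNormalizedBBasis (solutionSpace p) β (bFun v L U) := by
  have hsum := hb.sum_bCoeff_mul hdeg hroot hv hLU
  have hmem : ∀ i, bFun v L U i ∈ solutionSpace p := fun i => by
    rw [hb.bFun_eq hLU]
    exact Submodule.smul_mem _ (bCoeff L U i) (hv i)
  have hjet : ∀ i j u, iteratedDeriv j (bFun v L U i) u =
      bCoeff L U i * iteratedDeriv j (v i) u := fun i j u => by
    rw [hb.bFun_eq hLU, iteratedDeriv_const_mul_field]
  have hleft : ∀ i : Fin (n + 1), iteratedDeriv i (bFun v L U i) 0 = bCoeff L U i := fun i => by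
    rw [hjet, (hb.1 i).2, mul_one]
  have hzero : ∀ i : Fin (n + 1), VanishesToOrder (bFun v L U i) 0 i := fun i j hj => by
    rw [hjet, hb.vanishes_left i j hj, mul_zero]
  refine
    { basis := (linearIndependent_of_triangular_jets (fun i => (hmem i).1) hzero fun i => by
        rw [hleft]
        exact (hpos i).ne').isBasisOf hS hmem
      totallyPositive := fun m x c hx hc hxI => ?_
      sum_eq_one := fun u _ => by
        simp only [hb.bFun_eq hLU]
        exact hsum u
      left_value := ?_
      right_value := ?_
      left_zero := hzero
      left_pos := fun i => by
        rw [hleft]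
        exact hpos i
      right_zero := fun i j hij => by rw [hjet, hb.2 i j hij, mul_zero]
      right_pos := fun i => by
        have := mul_pos (hpos i) (hb.right_pos hβ hpar hv hZ i)
        rw [hjet]
        linarith }
  · simp only [hb.bFun_eq hLU]
    refine (Matrix.det_mul_row (fun l => bCoeff L U (c l))
      (Matrix.of fun k l => v (c l) (x k))).ge.trans' ?_
    exact mul_nonneg (Finset.prod_nonneg fun l _ => (hpos _).le)
      (hb.isTotallyPositiveOn hβ hv hZ m x c hx hc hxI)
  · have h := hsum 0
    rw [Finset.sum_eq_single 0 (fun i _ hi => by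
      have := hb.vanishes_left i 0 (Fin.pos_iff_ne_zero.2 hi)
      rw [iteratedDeriv_zero] at this
      rw [this, mul_zero]) (by simp)] at h
    rw [hb.bFun_eq hLU]
    exact h
  · have h := hsum β
    rw [Finset.sum_eq_single (Fin.last n) (fun i _ hi => by
      have := hb.vanishes_right i 0 (by
        have := Fin.val_lt_last hi
        omega)
      rw [iteratedDeriv_zero] at this
      rw [this, mul_zero]) (by simp)] at h
    rw [hb.bFun_eq hLU]
    exact h

theorem bCoeff_of_isNormalizedBBasis (hβ : 0 < β) (hdeg : p.natDegree = n + 1)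
    (hroot : p.eval 0 = 0)
    (hb : IsBicanonical β v) (hv : ∀ i, v i ∈ solutionSpace p)
    (hZ : ∀ f ∈ solutionSpace p, HasZeros f (Set.Icc 0 β) (n + 1) → f = 0)
    {L U : Matrix (Fin (n + 1)) (Fin (n + 1)) ℝ}
    (hLU : IsDoolittle (wronskianMatrix (fun k => v (Fin.rev k)) β) L U)
    {b : Fin (n + 1) → ℝ → ℝ} (hB : IsNormalizedBBasis (solutionSpace p) β b) :
    b = bFun v L U ∧ ∀ i, 0 < bCoeff L U i := by
  have hmem := hB.basis.mem
  have hbv : ∀ i : Fin (n + 1), b i = fun x => iteratedDeriv i (b i) 0 * v i x := fun i =>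
    hb.eq_mul hβ hv hZ (hmem i) i (hB.left_zero i) fun j hj => hB.right_zero i j (by omega)
  have hsum := hb.sum_bCoeff_mul hdeg hroot hv hLU
  have hg := solutionSpace.sum_mul_mem (p := p) Finset.univ
    (fun i : Fin (n + 1) => iteratedDeriv i (b i) 0) v fun i _ => hv i
  have key : (fun i : Fin (n + 1) => iteratedDeriv i (b i) 0) = bCoeff L U := by
    refine eq_of_sum_mul_eq (hb.linearIndependent hv) fun x => ?_
    rw [hsum x]
    have h1 := solutionSpace.one_mem hroot
    -- The partition of unity is given only on `[0, β]`. Around the interior point `β / 2` the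
    -- difference is locally zero, so it has an `(n + 1)`-fold zero and vanishes on the whole line.
    have hz : VanishesToOrder (0 : ℝ → ℝ) (β / 2) (n + 1) := fun j _ => by simp
    have h := solutionSpace.eq_zero_of_vanishesToOrder hdeg (Submodule.sub_mem _ hg h1)
      (hz.congr (by
        filter_upwards [Icc_mem_nhds (show 0 < β / 2 by linarith)
          (show β / 2 < β by linarith)] with y hy
        have hy1 := hB.sum_eq_one y hy
        rw [Finset.sum_congr rfl fun i _ => congrFun (hbv i) y] at hy1
        simp [hy1]))
    exact sub_eq_zero.1 (congrFun h x)
  have hpos : ∀ i, 0 < bCoeff L U i := fun i => by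
    rw [← key]
    exact hB.left_pos i
  refine ⟨?_, hpos⟩
  funext i
  rw [hbv i, hb.bFun_eq hLU, ← key]

end IsBicanonical

/-! ### Assembly in coordinates of the given basis -/

theorem mainTheorem7 (n : ℕ) (hn : 1 ≤ n)
    (p : Polynomial ℝ) (hdeg : p.natDegree = n + 1)
    (hpar : p.comp (-Polynomial.X) = p ∨ p.comp (-Polynomial.X) = -p)
    (hroot : p.eval 0 = 0)
    (φ : Fin (n + 1) → ℝ → ℝ) (hφ : IsBasisOf (solutionSpace p) φ)
    (β : ℝ) (hβ : 0 < β) (hcrit : (β : EReal) < criticalLength n (solutionSpace p)) :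
    -- the space contains the constants, is invariant under reflections and translations, and is EC
    (fun _ => (1 : ℝ)) ∈ solutionSpace p ∧
    (∀ f ∈ solutionSpace p, ∀ τ : ℝ,
      (fun u => f (τ - u)) ∈ solutionSpace p ∧ (fun u => f (u - τ)) ∈ solutionSpace p) ∧
    IsECSpace n (solutionSpace p) 0 β ∧
    -- the bicanonical basis exists and is unique
    (∃! ρ : Matrix (Fin (n + 1)) (Fin (n + 1)) ℝ, IsBicanonical β (particularIntegral ρ φ)) ∧
    ∀ ρ : Matrix (Fin (n + 1)) (Fin (n + 1)) ℝ, IsBicanonical β (particularIntegral ρ φ) →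
      IsBasisOf (solutionSpace p) (particularIntegral ρ φ) ∧
      -- the Doolittle factorization exists and is unique
      (∃! LU : Matrix (Fin (n + 1)) (Fin (n + 1)) ℝ × Matrix (Fin (n + 1)) (Fin (n + 1)) ℝ,
        IsDoolittle (wronskianMatrix (fun k => particularIntegral ρ φ (Fin.rev k)) β)
          LU.1 LU.2) ∧
      ∀ L U : Matrix (Fin (n + 1)) (Fin (n + 1)) ℝ,
        IsDoolittle (wronskianMatrix (fun k => particularIntegral ρ φ (Fin.rev k)) β) L U →
        -- the normalized B-basis: existence, uniqueness and identification with the construction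
        (∀ b : Fin (n + 1) → ℝ → ℝ, IsNormalizedBBasis (solutionSpace p) β b ↔
          b = bFun (particularIntegral ρ φ) L U ∧ ∀ i, 0 < L⁻¹ i 0 * U⁻¹ i i) ∧
        -- the derivative formulas
        (∀ (i : Fin (n + 1)) (j : ℕ) (u : ℝ),
          iteratedDeriv j (bFun (particularIntegral ρ φ) L U (Fin.rev i)) u =
              L⁻¹ i 0 * iteratedDeriv j (bTilde (particularIntegral ρ φ) U (Fin.rev i)) u ∧
          iteratedDeriv j (bFun (particularIntegral ρ φ) L U (Fin.rev i)) u =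
              L⁻¹ i 0 * ∑ r ∈ Finset.Iic i,
                U⁻¹ r i * iteratedDeriv j (particularIntegral ρ φ (Fin.rev r)) u ∧
          iteratedDeriv j (bFun (particularIntegral ρ φ) L U (Fin.rev i)) u =
              L⁻¹ i 0 * ∑ r ∈ Finset.Iic i,
                U⁻¹ r i * ∑ c, ρ (Fin.rev r) c * iteratedDeriv j (φ c) u) ∧
        -- the reflection formulas
        (∀ (i : Fin (n + 1)) (j : ℕ) (u : ℝ),
          iteratedDeriv j (bFun (particularIntegral ρ φ) L U i) u =
            (-1) ^ j *
              iteratedDeriv j (bFun (particularIntegral ρ φ) L U (Fin.rev i)) (β - u)) := by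

  have hS := solutionSpace.finrank_eq hφ
  have hZ : ∀ f ∈ solutionSpace p, HasZeros f (Set.Icc 0 β) (n + 1) → f = 0 := fun f hf =>
    solutionSpace.eq_zero_of_hasZeros hdeg hpar hS hf hcrit
  have hmem : ∀ ρ i, particularIntegral ρ φ i ∈ solutionSpace p := fun ρ i =>
    solutionSpace.sum_mul_mem _ _ _ fun j _ => hφ.mem j
  refine ⟨solutionSpace.one_mem hroot, fun f hf τ => ⟨solutionSpace.comp_const_sub_mem hpar hf τ,
    solutionSpace.comp_sub_const_mem hf τ⟩, solutionSpace.isECSpace hdeg hpar hS hcrit, ?_, ?_⟩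
  · obtain ⟨v, hv, hb⟩ := solutionSpace.exists_isBicanonical hβ hS hZ
    have hspan : ∀ i, ∃ c : Fin (n + 1) → ℝ, ∑ j, c j • φ j = v i := fun i =>
      (Submodule.mem_span_range_iff_exists_fun ℝ).1 (by rw [hφ.2]; exact hv i)
    choose ρ hρ using hspan
    have hρv : particularIntegral (Matrix.of ρ) φ = v := by
      ext i x
      rw [← hρ i]
      simp [particularIntegral]
    refine ⟨Matrix.of ρ, show IsBicanonical β _ by rwa [hρv], fun σ hσ => ?_⟩
    have hσv : particularIntegral σ φ = v := hb.unique hβ hv hZ hσ (hmem σ)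
    refine funext fun i => ?_
    exact eq_of_sum_mul_eq hφ.1 fun x =>
      (congrFun (congrFun hσv i) x).trans (congrFun (congrFun hρv i) x).symm
  · intro ρ hb
    have hv := hmem ρ
    refine ⟨(hb.linearIndependent hv).isBasisOf hS hv, hb.existsUnique_doolittle hβ hv hZ, ?_⟩
    intro L U hLU
    have hdiag : ∀ r i, r ≠ i → U⁻¹ r i = 0 := fun r i hri => by
      rw [hb.doolittle_inv hLU, Matrix.diagonal_apply_ne _ hri]
    have hfirst : ∀ (i : Fin (n + 1)) (j : ℕ) (u : ℝ),
        iteratedDeriv j (bFun (particularIntegral ρ φ) L U (Fin.rev i)) u =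
          L⁻¹ i 0 * iteratedDeriv j (bTilde (particularIntegral ρ φ) U (Fin.rev i)) u := by
      intro i j u
      unfold bFun
      rw [iteratedDeriv_const_mul_field, Fin.rev_rev]
    have hsecond : ∀ (i : Fin (n + 1)) (j : ℕ) (u : ℝ),
        iteratedDeriv j (bFun (particularIntegral ρ φ) L U (Fin.rev i)) u =
          L⁻¹ i 0 * ∑ r ∈ Finset.Iic i,
            U⁻¹ r i * iteratedDeriv j (particularIntegral ρ φ (Fin.rev r)) u := by
      intro i j u
      rw [hfirst, hb.bTilde_eq hLU, iteratedDeriv_const_mul_field, Fin.rev_rev,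
        -- `U⁻¹` is diagonal, so only the term `r = i` of the triangular sum contributes.
        Finset.sum_eq_single i (fun r _ hr => by rw [hdiag r i hr, zero_mul]) (by simp)]
    refine ⟨fun b => ⟨fun hB => ?_, ?_⟩, fun i j u => ⟨hfirst i j u, hsecond i j u, ?_⟩,
      fun i j u => ?_⟩
    · obtain ⟨h1, h2⟩ := hb.bCoeff_of_isNormalizedBBasis hβ hdeg hroot hv hZ hLU hB
      exact ⟨h1, fun i => by simpa [bCoeff] using h2 (Fin.rev i)⟩
    · rintro ⟨rfl, hpos⟩
      exact hb.isNormalizedBBasis_bFun hβ hdeg hpar hroot hS hv hZ hLU fun i => hpos (Fin.rev i)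
    · rw [hsecond]
      congr 1
      refine Finset.sum_congr rfl fun r _ => ?_
      rw [← iteratedDeriv_sum_mul _ _ _ fun c _ => (hφ.mem c).1]
      rfl
    · rw [← hb.bFun_comp_const_sub hβ hdeg hpar hroot hv hZ hLU i, iteratedDeriv_comp_const_sub]
      rfl
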